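/- Let $\mu$ be a nonzero real constant and consider the viscous transonic equation $$v_{yy}=2v_{xt}+v_xv_{xx}-v_{zz}-\mu v_{xxx}$$ in the independent variables $x,y,z,t$. Let $\mathcal F_{\mathcal E}$ be the algebra of smooth real functions of $x,y,z,t$ and of the derivatives $v_I=\partial_x^{i_1}\partial_z^{i_2}\partial_t^{i_3}v$ and $w_I=\partial_x^{i_1}\partial_z^{i_2}\partial_t^{i_3}v_y$, $I=(i_1,i_2,i_3)\in\mathbb Z_+^3$, each function depending on finitely many of these variables. Let $\bar D_x,\bar D_y,\bar D_z,\bar D_t$ be the total derivatives on $\mathcal F_{\mathcal E}$, where in $\bar D_y$ the derivative $v_{yy}$ and its derivatives are expressed through the equation: with $F=2v_{xt}+v_xv_{xx}-v_{zz}-\mu v_{xxx}$ and $\bar D^I=\bar D_x^{i_1}\bar D_z^{i_2}\bar D_t^{i_3}$, $$\bar D_y=\frac{\partial}{\partial y}+\sum_I w_I\frac{\partial}{\partial v_I}+\sum_I \bar D^I(F)\frac{\partial}{\partial w_I}.$$ A conserved current is a tuple $J=(J_y,J_x,J_z,J_t)$ of elements of $\mathcal F_{\mathcal E}$ with $\bar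 D_yJ_y+\bar D_xJ_x+\bar D_zJ_z+\bar D_tJ_t=0$. Numbering the independent variables as $y,x,z,t$, a current is trivial if $J_k=\sum_{l<k}\bar D_l(\mathcal L_{lk})-\sum_{k<l}\bar D_l(\mathcal L_{kl})$ for some $\mathcal L_{kl}\in\mathcal F_{\mathcal E}$, $k<l$; two currents are equivalent if they differ by a trivial one. The characteristic of $J$ is $\sum_I(-1)^{|I|}\bar D^I\bigl(\partial J_y/\partial w_I\bigr)$. 1. For every conserved current $J$, its characteristic is a smooth function $\chi=\chi(x,y,z,t)$ of the independent variables only, it satisfies $\chi_x=0$ and $\chi_{yy}+\chi_{zz}=0$, and $J$ is equivalent to the current $$J_y=\chi v_y-\chi_yv,\quad J_x=\mu\chi v_{xx}-\tfrac12\chi v_x^2-2\chi v_t,\quad J_z=\chi v_z-\chi_zv,\quad J_t=0.\qquad(*)$$ 2. Conversely, for every smooth function $\chi(x,y,z,t)$ with $\chi_x=0$ and $\chi_{yy}+\chi_{zz}=0$, the tuple $(*)$ is a conserved current and its characteristic is $\chi$. -/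

import Mathlib

namespace ViscousTransonic

/-- Partial derivative of a function of the variables `p c`, `c : ι`, with respect to the
variable number `c`. -/
noncomputable def pd {ι : Type} [DecidableEq ι] (c : ι) (f : (ι → ℝ) → ℝ) (p : ι → ℝ) : ℝ :=
  deriv (fun s : ℝ => f (Function.update p c s)) (p c)

/-- Internal coordinates on the infinitely prolonged equation
`v_yy = 2 v_xt + v_x v_xx - v_zz - μ v_xxx`, solved for `v_yy`.

* `Sum.inl i` is the independent variable number `i`, in the order `0 = y`, `1 = x`, `2 = z`,
  `3 = t`;
* `Sum.inr (s, I)`, with `s ∈ {0, 1}`, is the derivative of `v` of order `s` in `y` and of orders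
  `I 0`, `I 1`, `I 2` in `x`, `z`, `t`. -/
abbrev Coord : Type := Fin 4 ⊕ (Fin 2 × (Fin 3 → ℕ))

/-- A point: a value for each coordinate. -/
abbrev Pt : Type := Coord → ℝ

/-- Membership in the algebra of smooth functions of the internal coordinates: each function
depends smoothly on finitely many coordinates and on no others. -/
def IsSmooth (f : Pt → ℝ) : Prop :=
  ∃ (S : Finset Coord) (g : (S → ℝ) → ℝ),
    ContDiff ℝ (⊤ : ℕ∞) g ∧ ∀ p : Pt, f p = g (fun c => p c)

/-- The function `∂_y^s ∂_x^a ∂_z^b ∂_t^c v`, for `s ∈ {0, 1}`. -/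
def jet (s : Fin 2) (a b c : ℕ) (p : Pt) : ℝ := p (Sum.inr (s, ![a, b, c]))

/-- The total derivative in the variable `x`, `z`, `t` for `i = 0`, `1`, `2` respectively. The sum
has finitely many nonzero terms when `f` is smooth. -/
noncomputable def spaceD (i : Fin 3) (f : Pt → ℝ) (p : Pt) : ℝ :=
  pd (Sum.inl i.succ) f p +
    ∑ᶠ c : Fin 2 × (Fin 3 → ℕ), p (Sum.inr (c.1, c.2 + Pi.single i 1)) * pd (Sum.inr c) f p

/-- The iterated total derivative `D_x^(I 0) D_z^(I 1) D_t^(I 2)`. -/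
noncomputable def spaceDIter (I : Fin 3 → ℕ) (f : Pt → ℝ) : Pt → ℝ :=
  (spaceD 0)^[I 0] ((spaceD 1)^[I 1] ((spaceD 2)^[I 2] f))

/-- The right-hand side `2 v_xt + v_x v_xx - v_zz - μ v_xxx`. -/
def rhs (μ : ℝ) (p : Pt) : ℝ :=
  2 * jet 0 1 0 1 p + jet 0 1 0 0 p * jet 0 2 0 0 p - jet 0 0 2 0 p - μ * jet 0 3 0 0 p

/-- The total derivative in `y`, restricted to the equation: `v_yy` and its derivatives are replaced
by the right-hand side and its total derivatives. -/
noncomputable def evolD (μ : ℝ) (f : Pt → ℝ) (p : Pt) : ℝ :=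
  pd (Sum.inl 0) f p +
    (∑ᶠ I : Fin 3 → ℕ, p (Sum.inr (1, I)) * pd (Sum.inr (0, I)) f p) +
    ∑ᶠ I : Fin 3 → ℕ, spaceDIter I (rhs μ) p * pd (Sum.inr (1, I)) f p

/-- The total derivatives on the equation, in the order `y`, `x`, `z`, `t`. -/
noncomputable def totalD (μ : ℝ) (i : Fin 4) : (Pt → ℝ) → (Pt → ℝ) :=
  Fin.cases (evolD μ) spaceD i

/-- `J = (J_y, J_x, J_z, J_t)` is a conserved current. -/
def IsConservedCurrent (μ : ℝ) (J : Fin 4 → Pt → ℝ) : Prop :=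
  (∀ i, IsSmooth (J i)) ∧ ∀ p : Pt, ∑ i, totalD μ i (J i) p = 0

/-- `J` is trivial: `J_k = ∑_{l < k} D_l (L_lk) - ∑_{k < l} D_l (L_kl)` for some smooth `L_kl`,
`k < l`. -/
def IsTrivialCurrent (μ : ℝ) (J : Fin 4 → Pt → ℝ) : Prop :=
  ∃ L : Fin 4 → Fin 4 → Pt → ℝ, (∀ k l, k < l → IsSmooth (L k l)) ∧
    ∀ (k : Fin 4) (p : Pt), J k p =
      (∑ l ∈ Finset.univ.filter (fun l => l < k), totalD μ l (L l k) p) -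
        ∑ l ∈ Finset.univ.filter (fun l => k < l), totalD μ l (L k l) p

/-- Two currents are equivalent when they differ by a trivial one. -/
def CurrentEquiv (μ : ℝ) (J J' : Fin 4 → Pt → ℝ) : Prop :=
  IsTrivialCurrent μ (J - J')

/-- The characteristic of a conserved current,
`∑_I (-1)^|I| D^I (∂J_y / ∂(∂^I v_y))`, where `D^I` are the total derivatives in `x`, `z`, `t`. -/
noncomputable def characteristic (J : Fin 4 → Pt → ℝ) (p : Pt) : ℝ :=
  ∑ᶠ I : Fin 3 → ℕ, (-1) ^ (∑ i, I i) * spaceDIter I (pd (Sum.inr (1, I)) (J 0)) p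

/-- A function of the independent variables, regarded as a function of all coordinates. -/
def lift (χ : (Fin 4 → ℝ) → ℝ) (p : Pt) : ℝ := χ (fun i => p (Sum.inl i))

/-- `χ` is a smooth function of `(y, x, z, t)` with `χ_x = 0` and `χ_yy + χ_zz = 0`. -/
def IsAdmissible (χ : (Fin 4 → ℝ) → ℝ) : Prop :=
  ContDiff ℝ (⊤ : ℕ∞) χ ∧ (∀ q, pd 1 χ q = 0) ∧ ∀ q, pd 0 (pd 0 χ) q + pd 2 (pd 2 χ) q = 0

/-- The current with components
`J_y = χ v_y - χ_y v`, `J_x = μ χ v_xx - (1/2) χ v_x² - 2 χ v_t`, `J_z = χ v_z - χ_z v`,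
`J_t = 0`. -/
noncomputable def explicitCurrent (μ : ℝ) (χ : (Fin 4 → ℝ) → ℝ) : Fin 4 → Pt → ℝ :=
  ![fun p => lift χ p * jet 1 0 0 0 p - lift (pd 0 χ) p * jet 0 0 0 0 p,
    fun p => μ * lift χ p * jet 0 2 0 0 p - 1 / 2 * lift χ p * jet 0 1 0 0 p ^ 2
      - 2 * lift χ p * jet 0 0 0 1 p,
    fun p => lift χ p * jet 0 0 1 0 p - lift (pd 2 χ) p * jet 0 0 0 0 p,
    fun _ => 0]

end ViscousTransonic

namespace ViscousTransonic

open scoped ContDiff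

/-! ### Integrals of smooth functions depending on a parameter -/

/-! The argument is the generating-function method on the equation, viewed as an evolution system in
$y$ for $(v,w)$, $w=v_y$. Vertical one-forms $\sum g\,\theta_{(s,I)}$ carry the Lie derivatives `LD
i` and `LDy` along the total derivatives, and these commute with the vertical differential `dV`
(`lie_dV`). Integration by parts gives Euler operators `euler s` that kill space divergences.
Applying `dV` and `euler` to a conservation law shows that the characteristic $\psi$ = `euler 1 (dV
(J 0))` solves the adjoint linearized equation
$\psi_{yy}=2\psi_{xt}+v_x\psi_{xx}+v_{xx}\psi_x-\psi_{zz}+\mu\psi_{xxx}$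
(`isCosymmetry_of_conserved`).

Why $\psi$ contains no derivatives of $v$: give each of $x,z,t$ weight 2 and $y$ weight 3, so that
$D_y^2$ and $D_x^3$ both have weight 6. On vertical forms $D_y^2$ has leading part
$-\mu\,\theta_{xxx}$, while the adjoint equation contributes $+\mu\,\theta_{xxx}$. The two signs do
not match, and the leading part of $d_V\psi$, multiplied by $2\mu\ne0$, must vanish; all other terms
have lower weight. Descent on the weight gives $d_V\psi=0$ (`leading_mem`, `IsCosymmetry.mem_W`).
Then the coefficient of $v_{xx}$ forces $\psi_x=0$, and what remains is $\psi_{yy}+\psi_{zz}=0$.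

Subtracting the explicit current leaves a current of characteristic zero. Both Euler operators then
annihilate $J_y$, so $J_y=\sum D_ia_i$ (`exists_div`), and $(J_i+D_ya_i)$ is free of space
divergence, hence a curl (`exists_curl`). Both facts are proved first for vertical forms, by algebra
in the jet indices, then carried to functions by integrating along $v\mapsto sv$; what is left at
$v=0$ is handled by ordinary antiderivatives. -/

theorem hasFDerivAt_integral_of_contDiff {E F : Type} [NormedAddCommGroup E] [NormedSpace ℝ E]
    [FiniteDimensional ℝ E] [NormedAddCommGroup F] [NormedSpace ℝ F]
    {H : E × ℝ → F} (hH : ContDiff ℝ ∞ H) (x : E) :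
    HasFDerivAt (fun x => ∫ s in (0 : ℝ)..1, H (x, s))
      (∫ s in (0 : ℝ)..1, (fderiv ℝ H (x, s)).comp (ContinuousLinearMap.inl ℝ E ℝ)) x := by
  have hH' : Continuous fun q : E × ℝ =>
      (fderiv ℝ H q).comp (ContinuousLinearMap.inl ℝ E ℝ) :=
    (hH.continuous_fderiv (by simp)).clm_comp continuous_const
  have hpair : ∀ y : E, Continuous fun s : ℝ => (y, s) := fun y => by fun_prop
  -- The derivative in the parameter is bounded on the compact set (unit ball) × [0,1]; this
  -- constant dominates it.
  obtain ⟨C, hC⟩ := ((isCompact_closedBall x (1 : ℝ)).prod (isCompact_Icc (a := (0 : ℝ))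
    (b := 1))).exists_bound_of_continuousOn hH'.continuousOn
  refine intervalIntegral.hasFDerivAt_integral_of_dominated_of_fderiv_le
    (F := fun x s => H (x, s))
    (F' := fun x s => (fderiv ℝ H (x, s)).comp (ContinuousLinearMap.inl ℝ E ℝ))
    (bound := fun _ => C) (Metric.closedBall_mem_nhds x one_pos)
    (.of_forall fun y => (hH.continuous.comp (hpair y)).aestronglyMeasurable)
    ((hH.continuous.comp (hpair x)).intervalIntegrable 0 1)
    (hH'.comp (hpair x)).aestronglyMeasurable
    (.of_forall fun s hs y hy => hC (y, s) ⟨hy, ?_⟩)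
    intervalIntegrable_const
    (.of_forall fun s _ y _ => ?_)
  · rw [Set.uIoc_of_le zero_le_one] at hs
    exact ⟨hs.1.le, hs.2⟩
  · have h1 := (hH.differentiable (by simp) (y, s)).hasFDerivAt
    exact h1.comp y (hasFDerivAt_prodMk_left y s)

theorem hasDerivAt_integral_of_contDiff {H : ℝ × ℝ → ℝ} (hH : ContDiff ℝ ∞ H) {H' : ℝ → ℝ} {x : ℝ}
    (h : ∀ s, HasDerivAt (fun x => H (x, s)) (H' s) x) :
    HasDerivAt (fun x => ∫ s in (0 : ℝ)..1, H (x, s)) (∫ s in (0 : ℝ)..1, H' s) x := by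
  have hc : Continuous fun s : ℝ =>
      (fderiv ℝ H (x, s)).comp (ContinuousLinearMap.inl ℝ ℝ ℝ) :=
    ((hH.continuous_fderiv (by simp)).comp (by fun_prop)).clm_comp continuous_const
  have h1 := (hasFDerivAt_integral_of_contDiff hH x).hasDerivAt
  rw [ContinuousLinearMap.intervalIntegral_apply (hc.intervalIntegrable 0 1)] at h1
  refine h1.congr_deriv (intervalIntegral.integral_congr fun s _ => HasDerivAt.unique ?_ (h s))
  exact ((hH.differentiable (by simp) (x, s)).hasFDerivAt.comp x
    (hasFDerivAt_prodMk_left x s)).hasDerivAt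

/-- The derivative is again a parameter integral, with values in a space of linear maps, so the
induction on `n` must quantify over the target `F`. -/
theorem contDiff_integral {E : Type} [NormedAddCommGroup E] [NormedSpace ℝ E]
    [FiniteDimensional ℝ E] (n : ℕ) : ∀ {F : Type} [NormedAddCommGroup F] [NormedSpace ℝ F]
    {H : E × ℝ → F}, ContDiff ℝ ∞ H →
    ContDiff ℝ n (fun x => ∫ s in (0 : ℝ)..1, H (x, s)) := by
  induction n with
  | zero =>
    intro F _ _ H hH
    exact contDiff_zero.2 (continuous_iff_continuousAt.2
      fun x => (hasFDerivAt_integral_of_contDiff hH x).continuousAt)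
  | succ n ih =>
    intro F _ _ H hH
    rw [Nat.cast_succ, contDiff_succ_iff_fderiv]
    refine ⟨fun x => (hasFDerivAt_integral_of_contDiff hH x).differentiableAt, by simp, ?_⟩
    rw [funext fun x => (hasFDerivAt_integral_of_contDiff hH x).fderiv]
    exact ih ((hH.fderiv_right (m := ∞) (by simp)).clm_comp contDiff_const)

/-! ### Smooth functions of finitely many coordinates -/

/-- `g` represents `f` as a smooth function of the coordinates in `T`. -/
def Represents (T : Finset Coord) (g : (T → ℝ) → ℝ) (f : Pt → ℝ) : Prop :=
  ContDiff ℝ ∞ g ∧ ∀ p : Pt, f p = g (fun c => p c)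

theorem Represents.mono {S T : Finset Coord} (h : S ⊆ T) {g : (S → ℝ) → ℝ} {f : Pt → ℝ}
    (hf : Represents S g f) : Represents T (fun q => g (fun c => q ⟨c, h c.2⟩)) f :=
  ⟨hf.1.comp (by fun_prop), fun p => hf.2 p⟩

theorem Represents.isSmooth {T : Finset Coord} {g : (T → ℝ) → ℝ} {f : Pt → ℝ}
    (h : Represents T g f) : IsSmooth f := ⟨T, g, h⟩

theorem IsSmooth.represents {f : Pt → ℝ} (hf : IsSmooth f) :
    ∃ S : Finset Coord, ∀ T, S ⊆ T → ∃ g, Represents T g f :=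
  let ⟨S, _, h⟩ := hf
  ⟨S, fun _ hT => ⟨_, Represents.mono hT h⟩⟩

theorem IsSmooth.represents₂ {f f' : Pt → ℝ} (hf : IsSmooth f) (hf' : IsSmooth f') :
    ∃ (T : Finset Coord) (g g' : (T → ℝ) → ℝ), Represents T g f ∧ Represents T g' f' := by
  classical
  obtain ⟨S, h⟩ := hf.represents
  obtain ⟨S', h'⟩ := hf'.represents
  obtain ⟨g, hg⟩ := h (S ∪ S') Finset.subset_union_left
  obtain ⟨g', hg'⟩ := h' (S ∪ S') Finset.subset_union_right
  exact ⟨_, g, g', hg, hg'⟩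

theorem isSmooth_const (r : ℝ) : IsSmooth fun _ => r :=
  ⟨∅, fun _ => r, contDiff_const, fun _ => rfl⟩

theorem isSmooth_coord (c : Coord) : IsSmooth fun p => p c :=
  ⟨{c}, fun q => q ⟨c, Finset.mem_singleton_self c⟩, by fun_prop, fun _ => rfl⟩

theorem IsSmooth.add {f f' : Pt → ℝ} (hf : IsSmooth f) (hf' : IsSmooth f') :
    IsSmooth (f + f') := by
  obtain ⟨T, g, g', h, h'⟩ := hf.represents₂ hf'
  exact ⟨T, g + g', h.1.add h'.1, fun p => by simp [h.2, h'.2]⟩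

theorem IsSmooth.mul {f f' : Pt → ℝ} (hf : IsSmooth f) (hf' : IsSmooth f') :
    IsSmooth (f * f') := by
  obtain ⟨T, g, g', h, h'⟩ := hf.represents₂ hf'
  exact ⟨T, g * g', h.1.mul h'.1, fun p => by simp [h.2, h'.2]⟩

/-- The smooth functions as a subalgebra of the algebra of all functions. -/
def smoothSubalgebra : Subalgebra ℝ (Pt → ℝ) where
  carrier := {f | IsSmooth f}
  mul_mem' := IsSmooth.mul
  add_mem' := IsSmooth.add
  algebraMap_mem' := isSmooth_const

/-- The algebra of smooth functions. -/
def Sm : Type := smoothSubalgebra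

noncomputable instance : CommRing Sm := inferInstanceAs (CommRing smoothSubalgebra)

noncomputable instance : Algebra ℝ Sm := inferInstanceAs (Algebra ℝ smoothSubalgebra)

/-- A smooth function as an element of the algebra. -/
def Sm.mk (f : Pt → ℝ) (h : IsSmooth f) : Sm := (⟨f, h⟩ : smoothSubalgebra)

/-- The function underlying an element of the algebra. -/
@[coe] def Sm.val (f : Sm) : Pt → ℝ := (show smoothSubalgebra from f).1

instance : CoeOut Sm (Pt → ℝ) := ⟨Sm.val⟩

namespace Sm

theorem isSmooth (f : Sm) : IsSmooth f := (show smoothSubalgebra from f).2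

@[ext] theorem ext {f g : Sm} (h : ∀ p, (f : Pt → ℝ) p = (g : Pt → ℝ) p) : f = g :=
  Subtype.ext (funext h)

@[simp] theorem coe_mk (f : Pt → ℝ) (h : IsSmooth f) : (mk f h : Pt → ℝ) = f := rfl
@[simp] theorem coe_zero : ((0 : Sm) : Pt → ℝ) = 0 := rfl
@[simp] theorem coe_one : ((1 : Sm) : Pt → ℝ) = 1 := rfl
@[simp] theorem coe_add (f g : Sm) : ((f + g : Sm) : Pt → ℝ) = f + g := rfl
@[simp] theorem coe_sub (f g : Sm) : ((f - g : Sm) : Pt → ℝ) = f - g := rfl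
@[simp] theorem coe_neg (f : Sm) : ((-f : Sm) : Pt → ℝ) = -f := rfl
@[simp] theorem coe_mul (f g : Sm) : ((f * g : Sm) : Pt → ℝ) = f * g := rfl
@[simp] theorem coe_smul (r : ℝ) (f : Sm) : ((r • f : Sm) : Pt → ℝ) = r • (f : Pt → ℝ) := rfl

@[simp] theorem coe_sum {ι : Type*} (s : Finset ι) (f : ι → Sm) :
    ((∑ i ∈ s, f i : Sm) : Pt → ℝ) = ∑ i ∈ s, (f i : Pt → ℝ) :=
  map_sum (⟨⟨val, coe_zero⟩, coe_add⟩ : Sm →+ (Pt → ℝ)) f s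

end Sm

/-! ### Partial derivatives -/

section

variable {T : Finset Coord} {g : (T → ℝ) → ℝ} {f : Pt → ℝ}

theorem Represents.hasDerivAt_path (h : Represents T g f) {γ : ℝ → Pt} {γ' : Pt} {s : ℝ}
    (hγ : ∀ c, HasDerivAt (fun r => γ r c) (γ' c) s) :
    HasDerivAt (fun r => f (γ r)) (fderiv ℝ g (fun c => γ s c) (fun c => γ' c)) s := by
  have h1 : HasDerivAt (fun r => (fun c : T => γ r c)) (fun c => γ' c) s :=
    hasDerivAt_pi.2 fun c => hγ c
  have h2 := (h.1.differentiable (by simp) (fun c => γ s c)).hasFDerivAt.comp_hasDerivAt s h1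
  rw [funext fun r => h.2 (γ r)]
  exact h2

theorem hasDerivAt_update (p : Pt) (c d : Coord) (s : ℝ) :
    HasDerivAt (fun r => Function.update p c r d) ((Pi.single c 1 : Pt) d) s := by
  rcases eq_or_ne d c with rfl | hd
  · simpa using hasDerivAt_id' s
  · simpa [hd] using! hasDerivAt_const s (p d)

theorem Represents.pd_eq (h : Represents T g f) (c : Coord) (p : Pt) :
    pd c f p = fderiv ℝ g (fun d => p d) (fun d => (Pi.single c 1 : Pt) d) := by
  have := (h.hasDerivAt_path (hasDerivAt_update p c · (p c))).deriv
  rwa [Function.update_eq_self] at this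

theorem Represents.pd_eq_zero (h : Represents T g f) {c : Coord} (hc : c ∉ T) : pd c f = 0 := by
  funext p
  rw [h.pd_eq]
  have : (fun d : T => (Pi.single c 1 : Pt) d) = 0 := by
    funext d
    exact Pi.single_eq_of_ne (fun e => hc (by simp [← e])) _
  simp [this]

theorem Represents.fderiv_eq_sum (h : Represents T g f) (p v : Pt) :
    fderiv ℝ g (fun d => p d) (fun d => v d) = ∑ c ∈ T, v c * pd c f p := by
  rw [← ContinuousLinearMap.coe_coe, LinearMap.pi_apply_eq_sum_univ, ← Finset.sum_coe_sort T]
  refine Finset.sum_congr rfl fun c _ => ?_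
  rw [h.pd_eq, smul_eq_mul]
  rw [ContinuousLinearMap.coe_coe]
  congr 2
  funext d
  rw [Pi.single_apply]
  exact if_congr (by rw [Subtype.ext_iff]; exact eq_comm) rfl rfl

theorem Represents.pd (h : Represents T g f) (c : Coord) :
    Represents T (fun q => fderiv ℝ g q (fun d => (Pi.single c 1 : Pt) d)) (pd c f) :=
  ⟨(h.1.fderiv_right (m := ∞) (by simp)).clm_apply contDiff_const, h.pd_eq c⟩

theorem Represents.pd_comm (h : Represents T g f) (c d : Coord) :
    ViscousTransonic.pd c (ViscousTransonic.pd d f) =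
      ViscousTransonic.pd d (ViscousTransonic.pd c f) := by
  funext p
  rw [(h.pd d).pd_eq, (h.pd c).pd_eq]
  have hd : DifferentiableAt ℝ (fderiv ℝ g) (fun d => p d) :=
    (h.1.fderiv_right (m := ∞) (by simp)).differentiable (by simp) _
  rw [fderiv_clm_apply hd (by fun_prop), fderiv_clm_apply hd (by fun_prop)]
  simpa using (h.1.contDiffAt.isSymmSndFDerivAt (by simp; exact WithTop.coe_le_coe.2 le_top)) _ _

end

theorem IsSmooth.hasDerivAt_pd {f : Pt → ℝ} (hf : IsSmooth f) (c : Coord) (p : Pt) :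
    HasDerivAt (fun s => f (Function.update p c s)) (pd c f p) (p c) := by
  obtain ⟨T, g, h⟩ := hf
  have := Represents.hasDerivAt_path h (hasDerivAt_update p c · (p c))
  rwa [Function.update_eq_self, ← Represents.pd_eq h] at this

/-- The partial derivative as a derivation of the algebra of smooth functions. -/
noncomputable def pdA (c : Coord) : Derivation ℝ Sm Sm :=
  Derivation.mk'
    { toFun := fun f => .mk (pd c f) (let ⟨_, _, h⟩ := f.isSmooth; (Represents.pd h c).isSmooth)
      map_add' := fun f f' => by
        ext p
        exact ((f.isSmooth.hasDerivAt_pd c p).add (f'.isSmooth.hasDerivAt_pd c p)).deriv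
      map_smul' := fun r f => by
        ext p
        exact ((f.isSmooth.hasDerivAt_pd c p).const_mul r).deriv }
    (fun f f' => by
      ext p
      have := ((f.isSmooth.hasDerivAt_pd c p).mul (f'.isSmooth.hasDerivAt_pd c p)).deriv
      simp only [Function.update_eq_self] at this
      refine this.trans ?_
      simp only [LinearMap.coe_mk, AddHom.coe_mk, Sm.coe_mk, smul_eq_mul, Sm.coe_add,
        Sm.coe_mul, Pi.add_apply, Pi.mul_apply]
      ring)

@[simp] theorem pdA_coe (c : Coord) (f : Sm) : (pdA c f : Pt → ℝ) = pd c f := rfl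

theorem pdA_comm (c d : Coord) (f : Sm) : pdA c (pdA d f) = pdA d (pdA c f) :=
  let ⟨_, _, h⟩ := f.isSmooth
  Sm.ext (congrFun (Represents.pd_comm h c d))

/-- A coordinate function. -/
def coord (c : Coord) : Sm := .mk (fun p => p c) (isSmooth_coord c)

@[simp] theorem coord_coe (c : Coord) (p : Pt) : (coord c : Pt → ℝ) p = p c := rfl

theorem pdA_coord (c d : Coord) : pdA c (coord d) = if d = c then 1 else 0 := by
  ext p
  have := (hasDerivAt_update p c d (p c)).deriv
  refine this.trans ?_
  rw [Pi.single_apply]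
  split_ifs <;> rfl

theorem exists_pdA_eq_zero (f : Sm) : ∃ T : Finset Coord, ∀ c ∉ T, pdA c f = 0 :=
  let ⟨T, _, h⟩ := f.isSmooth
  ⟨T, fun _ hc => Sm.ext (congrFun (Represents.pd_eq_zero h hc))⟩

theorem pdA_support_finite (f : Sm) : (Function.support fun c => pdA c f).Finite := by
  obtain ⟨T, hT⟩ := exists_pdA_eq_zero f
  exact T.finite_toSet.subset fun c hc => by_contra fun h => hc (hT c h)

/-- A smooth function along a differentiable path. -/
theorem hasDerivAt_path (f : Sm) {T : Finset Coord} (hT : ∀ c ∉ T, pdA c f = 0)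
    {γ : ℝ → Pt} {γ' : Pt} {s : ℝ} (hγ : ∀ c, HasDerivAt (fun r => γ r c) (γ' c) s) :
    HasDerivAt (fun r => (f : Pt → ℝ) (γ r))
      (∑ c ∈ T, γ' c * (pdA c f : Pt → ℝ) (γ s)) s := by
  classical
  obtain ⟨S, h⟩ := f.isSmooth.represents
  obtain ⟨g, hg⟩ := h (S ∪ T) Finset.subset_union_left
  have := hg.hasDerivAt_path hγ
  rw [hg.fderiv_eq_sum] at this
  -- `T` need not contain the variables of a representative; the added terms have zero partial
  -- derivative.
  rw [Finset.sum_subset (Finset.subset_union_right (s₁ := S))]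
  · exact this
  · intro c _ hc
    simp [hT c hc]

/-! ### Averages along scalings of a set of coordinates -/

/-- The point with the coordinates `c` such that `k c = 1` multiplied by `s`; here `k` takes the
values `0` and `1`. -/
def scale (k : Coord → ℕ) (s : ℝ) (p : Pt) : Pt := fun c => s ^ k c * p c

/-- The mean value of `f` over the points `scale k s p`, `0 ≤ s ≤ 1`, with weight `s ^ j`. -/
noncomputable def meanFun (k : Coord → ℕ) (j : ℕ) (f : Pt → ℝ) (p : Pt) : ℝ :=
  ∫ s in (0 : ℝ)..1, s ^ j * f (scale k s p)

section

variable {T : Finset Coord} {g : (T → ℝ) → ℝ} {f : Pt → ℝ}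

theorem Represents.contDiff_scale (h : Represents T g f) (k : Coord → ℕ) (j : ℕ) :
    ContDiff ℝ ∞ fun z : (T → ℝ) × ℝ => z.2 ^ j * g (fun c => z.2 ^ k c * z.1 c) :=
  (contDiff_snd.pow j).mul (h.1.comp (contDiff_pi.2 fun c =>
    (contDiff_snd.pow _).mul ((contDiff_apply ℝ ℝ c).comp contDiff_fst)))

theorem Represents.meanFun (h : Represents T g f) (k : Coord → ℕ) (j : ℕ) :
    Represents T (fun q => ∫ s in (0 : ℝ)..1, s ^ j * g (fun c => s ^ k c * q c))
      (meanFun k j f) :=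
  ⟨contDiff_infty.2 fun n => contDiff_integral n (h.contDiff_scale k j), fun p => by
    simp only [ViscousTransonic.meanFun, h.2, scale]⟩

theorem Represents.continuous_scale (h : Represents T g f) (k : Coord → ℕ) (p : Pt) :
    Continuous fun s => f (scale k s p) := by
  simp only [h.2, scale]
  exact h.1.continuous.comp (by fun_prop)

end

theorem Sm.continuous_scale (f : Sm) (k : Coord → ℕ) (p : Pt) :
    Continuous fun s => (f : Pt → ℝ) (scale k s p) :=
  let ⟨_, _, h⟩ := f.isSmooth
  Represents.continuous_scale h k p

theorem Sm.intervalIntegrable_scale (f : Sm) (k : Coord → ℕ) (j : ℕ) (p : Pt) :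
    IntervalIntegrable (fun s => s ^ j * (f : Pt → ℝ) (scale k s p)) MeasureTheory.volume 0 1 :=
  ((continuous_id.pow j).mul (Sm.continuous_scale f k p)).intervalIntegrable 0 1

/-- `meanFun` on the algebra of smooth functions. -/
noncomputable def mean (k : Coord → ℕ) (j : ℕ) : Sm →ₗ[ℝ] Sm where
  toFun f := .mk (meanFun k j f) (let ⟨_, _, h⟩ := f.isSmooth; (Represents.meanFun h k j).isSmooth)
  map_add' f f' := by
    ext p
    refine Eq.trans ?_ (intervalIntegral.integral_add (Sm.intervalIntegrable_scale _ k j p)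
      (Sm.intervalIntegrable_scale _ k j p))
    simp only [Sm.coe_mk, meanFun, Sm.coe_add, Pi.add_apply, mul_add]
  map_smul' r f := by
    ext p
    refine Eq.trans ?_ (intervalIntegral.integral_const_mul r _)
    simp only [Sm.coe_mk, meanFun, Sm.coe_smul, Pi.smul_apply, smul_eq_mul, mul_left_comm]

theorem mean_coe (k : Coord → ℕ) (j : ℕ) (f : Sm) (p : Pt) :
    (mean k j f : Pt → ℝ) p = ∫ s in (0 : ℝ)..1, s ^ j * (f : Pt → ℝ) (scale k s p) := rfl

theorem scale_update (k : Coord → ℕ) (s : ℝ) (p : Pt) (c : Coord) (r : ℝ) :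
    scale k s (Function.update p c r) = Function.update (scale k s p) c (s ^ k c * r) := by
  funext d
  rcases eq_or_ne d c with rfl | hd
  · simp [scale]
  · simp [scale, hd]

/-- The chain rule produces a factor `s ^ k c`; the weight exponent `j` exists to absorb it. -/
theorem pdA_mean (k : Coord → ℕ) (j : ℕ) (c : Coord) (f : Sm) :
    pdA c (mean k j f) = mean k (j + k c) (pdA c f) := by
  obtain ⟨T, g, h⟩ := f.isSmooth
  ext p
  have hu : ContDiff ℝ ∞ fun z : ℝ × ℝ => ((fun d : T => Function.update p c z.1 d, z.2) :
      (T → ℝ) × ℝ) := by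
    refine ContDiff.prodMk (contDiff_pi.2 fun d => ?_) contDiff_snd
    rcases eq_or_ne (d : Coord) c with hd | hd
    · simpa [hd] using contDiff_fst
    · simpa [hd] using contDiff_const
  refine Eq.trans ?_ (hasDerivAt_integral_of_contDiff ((Represents.contDiff_scale h k j).comp hu)
    (x := p c) (H' := fun s => s ^ (j + k c) * (pdA c f : Pt → ℝ) (scale k s p)) fun s => ?_).deriv
  · refine congrArg (fun F : ℝ → ℝ => deriv F (p c)) (funext fun r => ?_)
    simp only [mean, Sm.coe_mk, meanFun, LinearMap.coe_mk, AddHom.coe_mk, h.2]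
    rfl
  · have h1 := f.isSmooth.hasDerivAt_pd c (scale k s p)
    have h2 := (HasDerivAt.comp (h := fun r => s ^ k c * r) (p c) h1
      ((hasDerivAt_id' (p c)).const_mul (s ^ k c))).const_mul (s ^ j)
    simp only [Function.comp_def, ← scale_update, h.2] at h2 ⊢
    refine h2.congr_deriv ?_
    rw [pow_add, pdA_coe]
    ring

/-- Fundamental theorem of calculus along a scaling. -/
theorem sum_coord_mul_mean (k : Coord → ℕ) (hk : ∀ c, k c = 0 ∨ k c = 1) (f : Sm)
    {T : Finset Coord} (hT : ∀ c ∉ T, pdA c f = 0) (p : Pt) :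
    ∑ c ∈ T with k c = 1, p c * (mean k 0 (pdA c f) : Pt → ℝ) p =
      (f : Pt → ℝ) p - (f : Pt → ℝ) (scale k 0 p) := by
  have h1 : ∀ s : ℝ, HasDerivAt (fun s => (f : Pt → ℝ) (scale k s p))
      (∑ c ∈ T with k c = 1, p c * (s ^ 0 * (pdA c f : Pt → ℝ) (scale k s p))) s := by
    intro s
    have := hasDerivAt_path f hT (γ := fun s => scale k s p)
      (γ' := fun c => if k c = 1 then p c else 0) (s := s) fun c => by
        rcases hk c with hc | hc
        · simpa [scale, hc] using hasDerivAt_const s (p c)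
        · simpa [scale, hc] using (hasDerivAt_id' s).mul_const (p c)
    simpa [Finset.sum_filter, ite_mul] using this
  have hint : ∀ c, IntervalIntegrable
      (fun s => p c * (s ^ 0 * (pdA c f : Pt → ℝ) (scale k s p))) MeasureTheory.volume 0 1 :=
    fun c => (Sm.intervalIntegrable_scale (pdA c f) k 0 p).const_mul _
  have h2 := intervalIntegral.integral_eq_sub_of_hasDerivAt (a := 0) (b := 1) (fun s _ => h1 s)
    (by simpa only [Finset.sum_fn] using! IntervalIntegrable.sum _ fun c _ => hint c)
  rw [intervalIntegral.integral_finsetSum fun c _ => hint c] at h2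
  rw [Finset.sum_congr rfl fun c _ => intervalIntegral.integral_const_mul _ _] at h2
  have h3 : scale k 1 p = p := by funext c; simp [scale]
  rw [h3] at h2
  exact h2

/-! ### Vector fields and vertical forms -/

/-- The differential, as the family of partial derivatives. -/
noncomputable def grad : Derivation ℝ Sm (Coord →₀ Sm) :=
  Derivation.mk'
    { toFun := fun f => Finsupp.ofSupportFinite (fun c => pdA c f) (pdA_support_finite f)
      map_add' := fun f f' => by
        ext1 c
        exact map_add (pdA c) f f'
      map_smul' := fun r f => by
        ext1 c
        exact (pdA c).map_smul r f }
    (fun f f' => by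
      ext1 c
      exact (pdA c).leibniz f f')

@[simp] theorem grad_apply (f : Sm) (c : Coord) : grad f c = pdA c f := rfl

/-- The derivation of the algebra of smooth functions defined by a vector field. -/
noncomputable def vf (X : Coord → Sm) : Derivation ℝ Sm Sm :=
  (Finsupp.linearCombination Sm X).compDer grad

theorem vf_apply (X : Coord → Sm) {f : Sm} {T : Finset Coord} (hT : ∀ c ∉ T, pdA c f = 0) :
    vf X f = ∑ c ∈ T, pdA c f * X c := by
  refine Finsupp.sum_of_support_subset (grad f) (fun c hc => ?_) (fun c a => a • X c) (by simp)
  by_contra h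
  exact Finsupp.mem_support_iff.1 hc (hT c h)

theorem vf_coord (X : Coord → Sm) (c : Coord) : vf X (coord c) = X c := by
  rw [vf_apply X (T := {c}) fun d hd => ?_]
  · simp [pdA_coord]
  · rw [pdA_coord, if_neg]
    simpa [eq_comm] using hd

theorem pdA_vf (X : Coord → Sm) {f : Sm} {T : Finset Coord} (hT : ∀ c ∉ T, pdA c f = 0)
    (d : Coord) : pdA d (vf X f) = vf X (pdA d f) + ∑ c ∈ T, pdA c f * pdA d (X c) := by
  rw [vf_apply X hT, vf_apply X (f := pdA d f) (T := T) fun c hc => by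
    rw [pdA_comm, hT c hc, map_zero], map_sum, ← Finset.sum_add_distrib]
  refine Finset.sum_congr rfl fun c _ => ?_
  rw [Derivation.leibniz, pdA_comm d c, smul_eq_mul, smul_eq_mul]
  ring

/-- A commutator of derivations is a derivation: the second-order terms cancel by symmetry of mixed
partials, so commuting on coordinates suffices. -/
theorem vf_comm {X Y : Coord → Sm} (h : ∀ c, vf X (Y c) = vf Y (X c)) (f : Sm) :
    vf X (vf Y f) = vf Y (vf X f) := by
  obtain ⟨T, hT⟩ := exists_pdA_eq_zero f
  have hT' : ∀ d, ∀ c ∉ T, pdA c (pdA d f) = 0 := fun d c hc => by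
    rw [pdA_comm, hT c hc, map_zero]
  have key : ∀ X Y : Coord → Sm, vf X (vf Y f) =
      ∑ c ∈ T, (pdA c f * vf X (Y c) + ∑ d ∈ T, pdA c (pdA d f) * (X c * Y d)) := by
    intro X Y
    rw [vf_apply Y hT, map_sum, Finset.sum_add_distrib, Finset.sum_comm, ← Finset.sum_add_distrib]
    refine Finset.sum_congr rfl fun c _ => ?_
    rw [Derivation.leibniz, vf_apply X (hT' c), smul_eq_mul, smul_eq_mul, Finset.mul_sum]
    congr 1
    refine Finset.sum_congr rfl fun d _ => ?_
    ring
  rw [key, key, Finset.sum_add_distrib, Finset.sum_add_distrib]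
  congr 1
  · exact Finset.sum_congr rfl fun c _ => by rw [h]
  · rw [Finset.sum_comm]
    refine Finset.sum_congr rfl fun c _ => Finset.sum_congr rfl fun d _ => ?_
    rw [pdA_comm]
    ring

/-- Indices of the derivatives of `v` which are coordinates. -/
abbrev Jet : Type := Fin 2 × (Fin 3 → ℕ)

/-- Vertical one-forms. -/
abbrev VForm : Type := Jet →₀ Sm

/-- The vertical differential. -/
noncomputable def dV : Derivation ℝ Sm VForm :=
  (Finsupp.lcomapDomain Sum.inr Sum.inr_injective : (Coord →₀ Sm) →ₗ[Sm] VForm).compDer grad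

@[simp] theorem dV_apply (f : Sm) (a : Jet) : dV f a = pdA (Sum.inr a) f := rfl

theorem dV_coord_inl (j : Fin 4) : dV (coord (Sum.inl j)) = 0 := by
  ext1 a
  simp [pdA_coord]

theorem dV_coord_inr (a : Jet) : dV (coord (Sum.inr a)) = Finsupp.single a 1 := by
  ext1 b
  simp [pdA_coord, Finsupp.single_apply]

/-- The Lie derivative of vertical forms. -/
noncomputable def lie (X : Coord → Sm) : VForm →ₗ[ℝ] VForm :=
  Finsupp.mapRange.linearMap (vf X).toLinearMap +
    (Finsupp.linearCombination Sm fun a => dV (X (Sum.inr a))).restrictScalars ℝ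

theorem lie_single (X : Coord → Sm) (a : Jet) (g : Sm) :
    lie X (Finsupp.single a g) = Finsupp.single a (vf X g) + g • dV (X (Sum.inr a)) := by
  simp [lie]

theorem lie_smul (X : Coord → Sm) (g : Sm) (c : VForm) :
    lie X (g • c) = vf X g • c + g • lie X c := by
  induction c using Finsupp.induction_linear with
  | zero => simp
  | add c c' h h' =>
    rw [smul_add, map_add, map_add, h, h', smul_add, smul_add]
    abel
  | single a r =>
    rw [Finsupp.smul_single, lie_single, lie_single, smul_eq_mul, Derivation.leibniz,
      smul_add, smul_smul, Finsupp.smul_single, Finsupp.smul_single, Finsupp.single_add,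
      smul_eq_mul, smul_eq_mul, smul_eq_mul, mul_comm r]
    abel

/-- Cartan's formula restricted to vertical forms. The components of `X` along the independent
variables must have no vertical differential, since otherwise the terms with partial derivatives of
`f` in those variables would survive. -/
theorem lie_dV {X : Coord → Sm} (hX : ∀ j, dV (X (Sum.inl j)) = 0) (f : Sm) :
    lie X (dV f) = dV (vf X f) := by
  obtain ⟨T, hT⟩ := exists_pdA_eq_zero f
  ext1 d
  rw [dV_apply, pdA_vf X hT]
  simp only [lie, LinearMap.add_apply, Finsupp.add_apply, Finsupp.mapRange.linearMap_apply,
    Finsupp.mapRange_apply]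
  congr 1
  have hT' : (dV f).support ⊆ T.toRight := fun a ha => by
    rw [Finset.mem_toRight]
    by_contra h
    exact Finsupp.mem_support_iff.1 ha (hT _ h)
  rw [LinearMap.restrictScalars_apply, Finsupp.linearCombination_apply,
    Finsupp.sum_of_support_subset _ hT' _ (by simp), Finsupp.finsetSum_apply,
    ← Finset.toLeft_disjSum_toRight (u := T), Finset.sum_disjSum]
  simp only [Finset.toRight_disjSum, Finsupp.smul_apply, smul_eq_mul, dV_apply]
  rw [Finset.sum_eq_zero (s := T.toLeft), zero_add]
  intro j _
  have := DFunLike.congr_fun (hX j) d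
  rw [dV_apply] at this
  rw [this]
  simp

theorem lie_comm {X Y : Coord → Sm} (h : ∀ c, vf X (Y c) = vf Y (X c))
    (hX : ∀ j, dV (X (Sum.inl j)) = 0) (hY : ∀ j, dV (Y (Sum.inl j)) = 0) (c : VForm) :
    lie X (lie Y c) = lie Y (lie X c) := by
  induction c using Finsupp.induction_linear with
  | zero => simp
  | add c c' h h' => simp only [map_add, h, h']
  | single a r =>
    simp only [lie_single, map_add, lie_smul, lie_dV hX, lie_dV hY, h, vf_comm h]
    abel

/-! ### Total derivatives -/

/-- The vector field of the total derivative in `x`, `z`, `t`. -/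
noncomputable def spaceField (i : Fin 3) : Coord → Sm :=
  Sum.elim (fun j => if j = i.succ then 1 else 0)
    (fun a => coord (Sum.inr (a.1, a.2 + Pi.single i 1)))

theorem spaceField_inr (i : Fin 3) (a : Jet) :
    spaceField i (Sum.inr a) = coord (Sum.inr (a.1, a.2 + Pi.single i 1)) := rfl

theorem dV_spaceField (i : Fin 3) (j : Fin 4) : dV (spaceField i (Sum.inl j)) = 0 := by
  simp only [spaceField, Sum.elim_inl]
  split_ifs <;> simp

theorem spaceField_comm (i j : Fin 3) (c : Coord) :
    vf (spaceField i) (spaceField j c) = vf (spaceField j) (spaceField i c) := by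
  rcases c with k | a
  · simp only [spaceField, Sum.elim_inl]
    split_ifs <;> simp
  · simp only [spaceField, Sum.elim_inr, vf_coord, add_right_comm]

/-- The total derivative in `x`, `z`, `t`, on the algebra of smooth functions. -/
noncomputable abbrev D (i : Fin 3) : Derivation ℝ Sm Sm := vf (spaceField i)

/-- The Lie derivative along the total derivative in `x`, `z`, `t`. -/
noncomputable abbrev LD (i : Fin 3) : VForm →ₗ[ℝ] VForm := lie (spaceField i)

theorem D_comm (i j : Fin 3) (f : Sm) : D i (D j f) = D j (D i f) := vf_comm (spaceField_comm i j) f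

theorem LD_comm (i j : Fin 3) (c : VForm) : LD i (LD j c) = LD j (LD i c) :=
  lie_comm (spaceField_comm i j) (dV_spaceField i) (dV_spaceField j) c

theorem LD_dV (i : Fin 3) (f : Sm) : LD i (dV f) = dV (D i f) := lie_dV (dV_spaceField i) f

theorem LD_single (i : Fin 3) (a : Jet) (g : Sm) :
    LD i (Finsupp.single a g) =
      Finsupp.single a (D i g) + Finsupp.single (a.1, a.2 + Pi.single i 1) g := by
  rw [lie_single, spaceField_inr, dV_coord_inr, Finsupp.smul_single_one]

/-- The iterated total derivatives. -/
noncomputable def DI (I : Fin 3 → ℕ) : Module.End ℝ Sm :=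
  (D 0).toLinearMap ^ I 0 * ((D 1).toLinearMap ^ I 1 * (D 2).toLinearMap ^ I 2)

@[simp] theorem DI_zero : DI 0 = 1 := by simp [DI]

theorem commute_D (i j : Fin 3) :
    Commute (D i).toLinearMap ((D j).toLinearMap : Module.End ℝ Sm) :=
  LinearMap.ext (D_comm i j)

theorem DI_add_single_eq_mul (I : Fin 3 → ℕ) (i : Fin 3) :
    DI (I + Pi.single i 1) = DI I * (D i).toLinearMap := by
  have h01 := (commute_D 0 1).pow_right (I 1)
  have h02 := (commute_D 0 2).pow_right (I 2)
  have h12 := (commute_D 1 2).pow_right (I 2)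
  fin_cases i
  · simp [DI, pow_succ, mul_assoc, (h01.mul_right h02).eq]
  · simp [DI, pow_succ, mul_assoc, h12.eq]
  · simp [DI, pow_succ, mul_assoc]

theorem DI_D (I : Fin 3 → ℕ) (i : Fin 3) (f : Sm) :
    DI I (D i f) = DI (I + Pi.single i 1) f := by
  rw [DI_add_single_eq_mul]; rfl

theorem DI_comm_D (I : Fin 3 → ℕ) (i : Fin 3) : Commute (DI I) (D i).toLinearMap :=
  ((commute_D 0 i).pow_left _).mul_left
    (((commute_D 1 i).pow_left _).mul_left ((commute_D 2 i).pow_left _))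

theorem D_DI (I : Fin 3 → ℕ) (i : Fin 3) (f : Sm) :
    D i (DI I f) = DI (I + Pi.single i 1) f := by
  rw [← DI_D]
  exact (LinearMap.congr_fun (DI_comm_D I i).eq f).symm

/-- The derivative `∂_y^s ∂_x^a ∂_z^b ∂_t^c v`. -/
def jt (s : Fin 2) (a b c : ℕ) : Sm := coord (Sum.inr (s, ![a, b, c]))

/-- The right-hand side of the equation. -/
noncomputable def rhsA (μ : ℝ) : Sm :=
  2 * jt 0 1 0 1 + jt 0 1 0 0 * jt 0 2 0 0 - jt 0 0 2 0 - μ • jt 0 3 0 0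

theorem rhsA_coe (μ : ℝ) : (rhsA μ : Pt → ℝ) = rhs μ := rfl

/-- The vector field of the total derivative in `y` on the equation. -/
noncomputable def evolField (μ : ℝ) : Coord → Sm :=
  Sum.elim (fun j => if j = 0 then 1 else 0)
    (fun a => if a.1 = 0 then coord (Sum.inr (1, a.2)) else DI a.2 (rhsA μ))

theorem evolField_zero (μ : ℝ) (I : Fin 3 → ℕ) :
    evolField μ (Sum.inr (0, I)) = coord (Sum.inr (1, I)) := rfl

theorem evolField_one (μ : ℝ) (I : Fin 3 → ℕ) :
    evolField μ (Sum.inr (1, I)) = DI I (rhsA μ) := rfl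

theorem dV_evolField (μ : ℝ) (j : Fin 4) : dV (evolField μ (Sum.inl j)) = 0 := by
  simp only [evolField, Sum.elim_inl]
  split_ifs <;> simp

/-- The total derivative in `y`, on the algebra of smooth functions. -/
noncomputable abbrev Dy (μ : ℝ) : Derivation ℝ Sm Sm := vf (evolField μ)

/-- The Lie derivative along the total derivative in `y`. -/
noncomputable abbrev LDy (μ : ℝ) : VForm →ₗ[ℝ] VForm := lie (evolField μ)

/-- The equation is prolonged by the space derivatives `DI I` of its right-hand side, which is
exactly compatibility of the flows. -/
theorem evolField_comm (μ : ℝ) (i : Fin 3) (c : Coord) :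
    vf (evolField μ) (spaceField i c) = vf (spaceField i) (evolField μ c) := by
  rcases c with k | ⟨s, I⟩
  · simp only [spaceField, evolField, Sum.elim_inl]
    split_ifs <;> simp
  · simp only [spaceField, Sum.elim_inr, vf_coord, evolField]
    split_ifs
    · rw [vf_coord]
      rfl
    · exact (D_DI I i _).symm

theorem Dy_D (μ : ℝ) (i : Fin 3) (f : Sm) : Dy μ (D i f) = D i (Dy μ f) :=
  vf_comm (evolField_comm μ i) f

theorem LDy_LD (μ : ℝ) (i : Fin 3) (c : VForm) : LDy μ (LD i c) = LD i (LDy μ c) :=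
  lie_comm (evolField_comm μ i) (dV_evolField μ) (dV_spaceField i) c

theorem LDy_dV (μ : ℝ) (f : Sm) : LDy μ (dV f) = dV (Dy μ f) := lie_dV (dV_evolField μ) f

theorem LDy_single_zero (μ : ℝ) (I : Fin 3 → ℕ) (g : Sm) :
    LDy μ (Finsupp.single (0, I) g) =
      Finsupp.single (0, I) (Dy μ g) + Finsupp.single (1, I) g := by
  rw [lie_single, evolField_zero, dV_coord_inr, Finsupp.smul_single_one]

theorem LDy_single_one (μ : ℝ) (I : Fin 3 → ℕ) (g : Sm) :
    LDy μ (Finsupp.single (1, I) g) =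
      Finsupp.single (1, I) (Dy μ g) + g • dV (DI I (rhsA μ)) := by
  rw [lie_single, evolField_one]

theorem exists_pdA_inr_eq_zero (f : Sm) : ∃ T : Finset Jet, ∀ a ∉ T, pdA (Sum.inr a) f = 0 := by
  obtain ⟨T, hT⟩ := exists_pdA_eq_zero f
  exact ⟨T.toRight, fun a ha => hT _ fun h => ha (Finset.mem_toRight.2 h)⟩

theorem vf_apply_split (X : Coord → Sm) {f : Sm} {T : Finset Jet}
    (hT : ∀ a ∉ T, pdA (Sum.inr a) f = 0) :
    vf X f = ∑ j, pdA (Sum.inl j) f * X (Sum.inl j) +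
      ∑ a ∈ T, pdA (Sum.inr a) f * X (Sum.inr a) := by
  rw [vf_apply X (T := Finset.univ.disjSum T), Finset.sum_disjSum]
  rintro (j | a) hc
  · simp at hc
  · exact hT a (by simpa using hc)

theorem D_coe (i : Fin 3) (f : Sm) : (D i f : Pt → ℝ) = spaceD i f := by
  obtain ⟨T, hT⟩ := exists_pdA_inr_eq_zero f
  funext p
  have hT' : ∀ a ∉ T, pd (Sum.inr a) f p = 0 := fun a ha =>
    congrFun (congrArg Sm.val (hT a ha)) p
  rw [spaceD, finsum_eq_sum_of_support_subset (s := T), vf_apply_split _ hT]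
  · simp [spaceField, mul_comm]
  · intro a ha
    by_contra h
    exact ha (by simp [hT' a h])

theorem DI_coe (I : Fin 3 → ℕ) (f : Sm) : (DI I f : Pt → ℝ) = spaceDIter I f := by
  have h : ∀ (i : Fin 3) (n : ℕ) (f : Sm),
      (((D i).toLinearMap ^ n : Module.End ℝ Sm) f : Pt → ℝ) = (spaceD i)^[n] f := by
    intro i n f
    rw [Module.End.pow_apply]
    exact (Function.Semiconj.iterate_right (f := ((↑) : Sm → Pt → ℝ)) (D_coe i) n) f
  simp only [DI, Module.End.mul_apply, h, spaceDIter]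

theorem Dy_coe (μ : ℝ) (f : Sm) : (Dy μ f : Pt → ℝ) = evolD μ f := by
  obtain ⟨T, hT⟩ := exists_pdA_inr_eq_zero f
  -- A product index set lets one finite set of multi-indices serve both sums, over $v_I$ and over
  -- $w_I$.
  have hT' : ∀ a ∉ Finset.univ ×ˢ T.image Prod.snd, pdA (Sum.inr a) f = 0 := fun a ha =>
    hT a fun h => ha (Finset.mem_product.2 ⟨Finset.mem_univ _, Finset.mem_image_of_mem _ h⟩)
  funext p
  have h0 : ∀ s, ∀ I ∉ T.image Prod.snd, pd (Sum.inr (s, I)) f p = 0 := fun s I hI =>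
    congrFun (congrArg Sm.val (hT' (s, I) (by simpa using hI))) p
  rw [evolD, finsum_eq_sum_of_support_subset (s := T.image Prod.snd),
    finsum_eq_sum_of_support_subset (s := T.image Prod.snd), vf_apply_split _ hT',
    Finset.sum_product, Fin.sum_univ_two]
  · simp [evolField, mul_comm, DI_coe, rhsA_coe]
    ring
  all_goals
    intro I hI
    by_contra h
    exact hI (by simp only [h0 _ I h, mul_zero])

/-! ### The Euler operator -/

/-- The formal adjoint of an iterated total derivative. -/
noncomputable def adjDI (I : Fin 3 → ℕ) : Module.End ℝ Sm := (-1 : ℝ) ^ (∑ i, I i) • DI I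

theorem adjDI_zero : adjDI 0 = 1 := by simp [adjDI]

theorem adjDI_add_single (I : Fin 3 → ℕ) (i : Fin 3) (f : Sm) :
    adjDI (I + Pi.single i 1) f = -adjDI I (D i f) := by
  simp [adjDI, DI_D, Finset.sum_add_distrib, pow_succ]

/-- Integration by parts: `g θ_(s,I)` is sent to `(-D)^I g`. -/
noncomputable def euler (s : Fin 2) : VForm →ₗ[ℝ] Sm :=
  Finsupp.lsum ℝ fun a => if a.1 = s then adjDI a.2 else 0

theorem euler_single (s : Fin 2) (a : Jet) (g : Sm) :
    euler s (Finsupp.single a g) = if a.1 = s then adjDI a.2 g else 0 := by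
  rw [euler, Finsupp.lsum_single]
  split_ifs <;> rfl

/-- The two terms of `LD_single` contribute $(-D)^I D_ir$ and $(-D)^{I+1_i}r$, which are opposite.
-/
theorem euler_LD (s : Fin 2) (i : Fin 3) (c : VForm) : euler s (LD i c) = 0 := by
  induction c using Finsupp.induction_linear with
  | zero => simp
  | add c c' h h' => rw [map_add, map_add, h, h', add_zero]
  | single a r =>
    rw [LD_single, map_add, euler_single, euler_single]
    split_ifs
    · rw [adjDI_add_single, add_neg_cancel]
    · exact add_zero 0

theorem exists_eq_add_single {I : Fin 3 → ℕ} {i : Fin 3} (h : I i ≠ 0) :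
    ∃ I' : Fin 3 → ℕ, I = I' + Pi.single i 1 := by
  refine ⟨I - Pi.single i 1, (tsub_add_cancel_of_le fun j => ?_).symm⟩
  rcases eq_or_ne j i with rfl | hj
  · simpa [Nat.one_le_iff_ne_zero] using h
  · simp [hj]

theorem sum_add_single (I : Fin 3 → ℕ) (i : Fin 3) :
    ∑ j, (I + Pi.single i 1 : Fin 3 → ℕ) j = ∑ j, I j + 1 := by
  simp [Finset.sum_add_distrib]

theorem index_induction {P : (Fin 3 → ℕ) → Prop} (h0 : P 0)
    (h : ∀ I i, P I → P (I + Pi.single i 1)) (I : Fin 3 → ℕ) : P I := by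
  by_cases hI : ∃ i, I i ≠ 0
  · obtain ⟨i, hi⟩ := hI
    obtain ⟨I', rfl⟩ := exists_eq_add_single hi
    exact h I' i (index_induction h0 h I')
  · push Not at hI
    rwa [show I = 0 from funext hI]
termination_by ∑ i, I i
decreasing_by
  subst I
  rw [sum_add_single]
  omega

/-- The horizontal divergence of vertical forms. -/
noncomputable def divV : (Fin 3 → VForm) →ₗ[ℝ] VForm := LinearMap.lsum ℝ (fun _ => VForm) ℝ LD

theorem divV_apply (a : Fin 3 → VForm) : divV a = ∑ i, LD i (a i) := by simp [divV]

theorem LD_mem_range (i : Fin 3) (c : VForm) : LD i c ∈ LinearMap.range divV :=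
  by
  refine ⟨Pi.single i c, ?_⟩
  rw [divV_apply, Finset.sum_eq_single i, Pi.single_eq_same]
  · intro j _ hj
    rw [Pi.single_eq_of_ne hj, map_zero]
  · simp

/-- Integration by parts, one derivative at a time: $g\,\theta_{I+1_i}\equiv-(D_ig)\,\theta_I$
modulo divergences. -/
theorem single_sub_mem_range (s : Fin 2) (I : Fin 3 → ℕ) : ∀ g,
    Finsupp.single (s, I) g - Finsupp.single (s, 0) (adjDI I g) ∈ LinearMap.range divV := by
  induction I using index_induction with
  | h0 =>
    intro g
    rw [adjDI_zero, Module.End.one_apply, sub_self]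
    exact zero_mem _
  | h I i ih =>
    intro g
    have := sub_mem (LD_mem_range i (Finsupp.single (s, I) g)) (ih (D i g))
    rw [LD_single] at this
    convert this using 1
    rw [adjDI_add_single, Finsupp.single_neg]
    abel

theorem sub_euler_mem_range (c : VForm) :
    c - ∑ s, Finsupp.single (s, 0) (euler s c) ∈ LinearMap.range divV := by
  induction c using Finsupp.induction_linear with
  | zero =>
    simp only [map_zero, Finsupp.single_zero, Finset.sum_const_zero, sub_zero]
    exact zero_mem _
  | add c c' h h' =>
    convert add_mem h h' using 1
    simp only [map_add, Finsupp.single_add, Finset.sum_add_distrib]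
    abel
  | single a r =>
    convert single_sub_mem_range a.1 a.2 r using 2
    rw [Finset.sum_eq_single a.1]
    · simp [euler_single]
    · intro s _ hs
      simp [euler_single, hs.symm]
    · simp

theorem exists_divV_eq (c : VForm) :
    ∃ a : Fin 3 → VForm, c = ∑ i, LD i (a i) + ∑ s, Finsupp.single (s, 0) (euler s c) := by
  obtain ⟨a, ha⟩ := sub_euler_mem_range c
  exact ⟨a, by rw [← divV_apply, ha, sub_add_cancel]⟩

/-! ### Exactness of the horizontal complex of vertical forms -/

/-- Vertical forms without derivatives in the space variable number `i`. -/
def NoDeriv (i : Fin 3) (c : VForm) : Prop := ∀ a : Jet, a.2 i ≠ 0 → c a = 0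

theorem NoDeriv.add {i : Fin 3} {c c' : VForm} (h : NoDeriv i c) (h' : NoDeriv i c') :
    NoDeriv i (c + c') := fun a ha => by rw [Finsupp.add_apply, h a ha, h' a ha, add_zero]

theorem NoDeriv.neg {i : Fin 3} {c : VForm} (h : NoDeriv i c) : NoDeriv i (-c) := fun a ha => by
  rw [Finsupp.neg_apply, h a ha, neg_zero]

theorem LD_apply_add_single (i : Fin 3) (c : VForm) (a : Jet) :
    LD i c (a.1, a.2 + Pi.single i 1) = D i (c (a.1, a.2 + Pi.single i 1)) + c a := by
  induction c using Finsupp.induction_linear with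
  | zero => simp
  | add c c' h h' =>
    rw [map_add, Finsupp.add_apply, h, h', Finsupp.add_apply, map_add, Finsupp.add_apply]
    abel
  | single b r =>
    rw [LD_single, Finsupp.add_apply]
    congr 1
    · rw [Finsupp.single_apply, Finsupp.single_apply]
      split_ifs <;> simp
    · simp only [Finsupp.single_apply, Prod.ext_iff, add_left_inj]

theorem NoDeriv.LD {i j : Fin 3} (hij : i ≠ j) {c : VForm} (h : NoDeriv i c) :
    NoDeriv i (LD j c) := by
  intro a ha
  rw [show c = c.sum Finsupp.single from c.sum_single.symm, Finsupp.sum, map_sum,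
    Finsupp.finsetSum_apply]
  refine Finset.sum_eq_zero fun b hb => ?_
  have hb' : b.2 i = 0 := by
    by_contra h'
    exact Finsupp.mem_support_iff.1 hb (h b h')
  rw [LD_single, Finsupp.add_apply, Finsupp.single_eq_of_ne, Finsupp.single_eq_of_ne, add_zero]
  · rintro rfl
    simp [hij, hb'] at ha
  · rintro rfl
    exact ha hb'

/-- The same integration by parts, in the single direction `i`, lowers the order in that direction
until none is left. -/
theorem exists_noDeriv (i : Fin 3) (c : VForm) : ∃ h c₀, NoDeriv i c₀ ∧ c = LD i h + c₀ := by
  induction c using Finsupp.induction_linear with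
  | zero => exact ⟨0, 0, fun _ _ => rfl, by simp⟩
  | add c c' h h' =>
    obtain ⟨h, c₀, h0, rfl⟩ := h
    obtain ⟨h', c₀', h0', rfl⟩ := h'
    exact ⟨h + h', c₀ + c₀', h0.add h0', by rw [map_add]; abel⟩
  | single a r =>
    obtain ⟨s, I⟩ := a
    induction hn : I i generalizing I r with
    | zero =>
      refine ⟨0, _, fun b hb => ?_, by rw [map_zero, zero_add]⟩
      rw [Finsupp.single_eq_of_ne]
      rintro rfl
      exact hb hn
    | succ n ih =>
      obtain ⟨I', rfl⟩ := exists_eq_add_single (I := I) (i := i) (by omega)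
      obtain ⟨h, c₀, h0, e⟩ := ih (-D i r) I' (by simpa using hn)
      refine ⟨Finsupp.single (s, I') r + h, c₀, h0, ?_⟩
      rw [map_add, add_assoc, ← e, LD_single, Finsupp.single_neg]
      abel

/-- A term of `c` of maximal order in direction `i` is shifted by `LD i` to an order that nothing
else reaches, so it cannot cancel. -/
theorem eq_zero_of_noDeriv_LD {i : Fin 3} {c : VForm} (h : NoDeriv i (LD i c)) : c = 0 := by
  by_contra hc
  obtain ⟨a, ha, hmax⟩ := c.support.exists_max_image (fun a => a.2 i)
    (Finsupp.support_nonempty_iff.2 hc)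
  have h1 : c (a.1, a.2 + Pi.single i 1) = 0 := by
    by_contra h'
    have := hmax _ (Finsupp.mem_support_iff.2 h')
    simp at this
  have h2 := LD_apply_add_single i c a
  rw [h (a.1, a.2 + Pi.single i 1) (by simp), h1, map_zero, zero_add] at h2
  exact Finsupp.mem_support_iff.1 ha h2.symm

/-- A divergence-free triple of vertical forms is a curl. -/
theorem exists_curl_vForm {a b c : VForm} (h : LD 0 a + LD 1 b + LD 2 c = 0) :
    ∃ l m n : VForm, a = -LD 1 l - LD 2 m ∧ b = LD 0 l - LD 2 n ∧ c = LD 0 m + LD 1 n := by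
  obtain ⟨l, b₀, hb₀, rfl⟩ := exists_noDeriv 0 b
  obtain ⟨m, c₀, hc₀, rfl⟩ := exists_noDeriv 0 c
  obtain ⟨n, c₁, hc₁, rfl⟩ := exists_noDeriv 1 c₀
  have e1 : LD 0 (a + LD 1 l + LD 2 m) = -(LD 1 b₀ + LD 2 (LD 1 n + c₁)) := by
    rw [eq_neg_iff_add_eq_zero, ← h]
    simp only [map_add]
    rw [LD_comm 0 1 l, LD_comm 0 2 m]
    abel
  -- The right-hand side of `e1` has no $x$-derivatives, while the left is an image of `LD 0`; so
  -- both sides vanish. The same separation is then used for $z$ and for $t$.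
  have h1 : a + LD 1 l + LD 2 m = 0 := by
    refine eq_zero_of_noDeriv_LD (i := 0) ?_
    rw [e1]
    exact ((hb₀.LD (by decide)).add (hc₀.LD (by decide))).neg
  rw [h1, map_zero, eq_comm, neg_eq_zero] at e1
  have e2 : LD 1 (b₀ + LD 2 n) = -LD 2 c₁ := by
    rw [eq_neg_iff_add_eq_zero, ← e1]
    simp only [map_add]
    rw [LD_comm 1 2 n]
    abel
  have h2 : b₀ + LD 2 n = 0 := by
    refine eq_zero_of_noDeriv_LD (i := 1) ?_
    rw [e2]
    exact (hc₁.LD (by decide)).neg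
  rw [h2, map_zero, eq_comm, neg_eq_zero] at e2
  have h3 : c₁ = 0 := by
    refine eq_zero_of_noDeriv_LD (i := 2) ?_
    rw [e2]
    exact fun _ _ => rfl
  refine ⟨l, m, n, ?_, ?_, ?_⟩
  · rw [← sub_eq_zero, ← h1]; abel
  · rw [eq_neg_of_add_eq_zero_left h2]; abel
  · rw [h3]; abel

/-! ### The homotopy -/

/-- Integration of vertical forms along the scaling of the jet coordinates. -/
noncomputable def integ : VForm →ₗ[ℝ] Sm :=
  Finsupp.lsum ℝ fun a => LinearMap.mulLeft ℝ (coord (Sum.inr a)) ∘ₗ mean (Sum.elim 0 1) 0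

theorem integ_single (a : Jet) (g : Sm) :
    integ (Finsupp.single a g) = coord (Sum.inr a) * mean (Sum.elim 0 1) 0 g := by
  rw [integ, Finsupp.lsum_single]
  rfl

theorem mean_coord_mul (k : Coord → ℕ) (j : ℕ) (c : Coord) (f : Sm) :
    mean k j (coord c * f) = coord c * mean k (j + k c) f := by
  ext p
  rw [Sm.coe_mul, Pi.mul_apply, mean_coe, mean_coe, coord_coe,
    ← intervalIntegral.integral_const_mul]
  refine intervalIntegral.integral_congr fun s _ => ?_
  simp only [Sm.coe_mul, Pi.mul_apply, coord_coe, scale, pow_add]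
  ring

theorem D_apply_split (i : Fin 3) {f : Sm} {T : Finset Jet}
    (hT : ∀ a ∉ T, pdA (Sum.inr a) f = 0) :
    D i f = pdA (Sum.inl i.succ) f +
      ∑ a ∈ T, coord (Sum.inr (a.1, a.2 + Pi.single i 1)) * pdA (Sum.inr a) f := by
  rw [vf_apply_split _ hT]
  congr 1
  · simp [spaceField]
  · exact Finset.sum_congr rfl fun a _ => mul_comm _ _

/-- The field of `D i` is linear in the jet coordinates: the factor `s` from scaling its coefficient
matches the one from the chain rule. The nonlinear `Dy` has no such property, so only space
derivatives pass through the homotopy. -/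
theorem D_mean (i : Fin 3) (f : Sm) :
    D i (mean (Sum.elim 0 1) 0 f) = mean (Sum.elim 0 1) 0 (D i f) := by
  obtain ⟨T, hT⟩ := exists_pdA_inr_eq_zero f
  rw [D_apply_split i hT, D_apply_split i (T := T) fun a ha => by rw [pdA_mean, hT a ha, map_zero]]
  simp only [pdA_mean, map_add, map_sum, mean_coord_mul]
  rfl

theorem integ_LD (i : Fin 3) (c : VForm) : integ (LD i c) = D i (integ c) := by
  induction c using Finsupp.induction_linear with
  | zero => simp
  | add c c' h h' => simp only [map_add, h, h']
  | single a r =>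
    rw [LD_single, map_add, integ_single, integ_single, integ_single, Derivation.leibniz, D_mean,
      vf_coord, spaceField_inr, smul_eq_mul, smul_eq_mul]
    ring

/-- The fundamental theorem of calculus along the segment that scales all derivatives of $v$ from 0
to their values. -/
theorem integ_dV (f : Sm) (p : Pt) :
    (integ (dV f) : Pt → ℝ) p =
      (f : Pt → ℝ) p - (f : Pt → ℝ) (Sum.elim (fun j => p (Sum.inl j)) 0) := by
  obtain ⟨T, hT⟩ := exists_pdA_inr_eq_zero f
  have h := sum_coord_mul_mean (Sum.elim 0 1) (by rintro (_ | _) <;> simp) f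
    (T := Finset.univ.disjSum T) (by
      rintro (j | a) hc
      · simp at hc
      · exact hT a (by simpa using hc)) p
  rw [Finset.sum_filter, Finset.sum_disjSum] at h
  have hs : scale (Sum.elim 0 1) 0 p = Sum.elim (fun j => p (Sum.inl j)) 0 := by
    funext c
    rcases c with j | a <;> simp [scale]
  rw [← hs, ← h, show dV f = (dV f).sum Finsupp.single from (dV f).sum_single.symm,
    Finsupp.sum_of_support_subset (s := T) _ _ _ (by simp), map_sum]
  · simp [integ_single]
  · intro a ha
    by_contra h'
    exact Finsupp.mem_support_iff.1 ha (hT a h')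

/-- The restriction of a smooth function to `v = 0`, as a function of all coordinates. -/
noncomputable def base (f : Sm) : Sm := f - integ (dV f)

theorem base_coe (f : Sm) (p : Pt) :
    (base f : Pt → ℝ) p = (f : Pt → ℝ) (Sum.elim (fun j => p (Sum.inl j)) 0) := by
  simp [base, integ_dV]

theorem dV_base (f : Sm) : dV (base f) = 0 := by
  ext1 a
  ext p
  have : ∀ s, (base f : Pt → ℝ) (Function.update p (Sum.inr a) s) = (base f : Pt → ℝ) p := by
    intro s
    simp [base_coe]
  simp [pd, this]

theorem D_base (i : Fin 3) (f : Sm) : D i (base f) = base (D i f) := by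
  rw [base, base, map_sub, ← integ_LD, LD_dV]

/-- A function with vanishing variational derivatives is a divergence up to a function of the
independent variables. -/
theorem exists_div_of_euler {f : Sm} (h : ∀ s, euler s (dV f) = 0) :
    ∃ a : Fin 3 → Sm, f = base f + ∑ i, D i (a i) := by
  obtain ⟨a, ha⟩ := exists_divV_eq (dV f)
  simp only [h, Finsupp.single_zero, Finset.sum_const_zero, add_zero] at ha
  refine ⟨fun i => integ (a i), ?_⟩
  simp only [← integ_LD, ← map_sum, ← ha, base, sub_add_cancel]

/-! ### Functions of the independent variables -/

/-- The antiderivative in an independent variable. -/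
noncomputable def anti (j : Fin 4) (f : Sm) : Sm :=
  coord (Sum.inl j) * mean (Pi.single (Sum.inl j) 1) 0 f

theorem dV_mean {k : Coord → ℕ} {f : Sm} (h : dV f = 0) : dV (mean k 0 f) = 0 := by
  ext1 a
  rw [dV_apply, pdA_mean, ← dV_apply, h]
  simp

theorem dV_anti (j : Fin 4) {f : Sm} (h : dV f = 0) : dV (anti j f) = 0 := by
  rw [anti, Derivation.leibniz, dV_mean h, dV_coord_inl, smul_zero, smul_zero, add_zero]

theorem anti_coe (j : Fin 4) (f : Sm) (p : Pt) : (anti j f : Pt → ℝ) p =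
    ∫ s in (0 : ℝ)..p (Sum.inl j), (f : Pt → ℝ) (Function.update p (Sum.inl j) s) := by
  have := intervalIntegral.smul_integral_comp_mul_right (a := 0) (b := 1)
    (fun s => (f : Pt → ℝ) (Function.update p (Sum.inl j) s)) (p (Sum.inl j))
  rw [zero_mul, one_mul] at this
  rw [← this, anti, Sm.coe_mul, Pi.mul_apply, mean_coe, coord_coe, smul_eq_mul]
  congr 1
  refine intervalIntegral.integral_congr fun s _ => ?_
  simp only [pow_zero, one_mul]
  refine congrArg (f : Pt → ℝ) ?_
  funext c
  rcases eq_or_ne c (Sum.inl j) with rfl | hc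
  · simp [scale]
  · simp [scale, hc]

theorem pdA_anti_self (j : Fin 4) (f : Sm) : pdA (Sum.inl j) (anti j f) = f := by
  ext p
  have hc : Continuous fun s => (f : Pt → ℝ) (Function.update p (Sum.inl j) s) :=
    continuous_iff_continuousAt.2 fun s => by
      have := (f.isSmooth.hasDerivAt_pd (Sum.inl j) (Function.update p (Sum.inl j) s)).continuousAt
      simpa using this
  have := intervalIntegral.deriv_integral_right (hc.intervalIntegrable 0 (p (Sum.inl j)))
    (hc.stronglyMeasurableAtFilter _ _) hc.continuousAt
  rw [Function.update_eq_self] at this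
  rw [← this, pdA_coe, pd]
  congr 1
  funext s
  simp [anti_coe]

theorem pdA_anti_of_ne {j : Fin 4} {c : Coord} (hc : c ≠ Sum.inl j) {f : Sm}
    (h : pdA c f = 0) : pdA c (anti j f) = 0 := by
  rw [anti, Derivation.leibniz, pdA_mean, h, pdA_coord, if_neg hc.symm]
  simp

theorem vf_of_dV_eq_zero (X : Coord → Sm) {f : Sm} (h : dV f = 0) :
    vf X f = ∑ j, pdA (Sum.inl j) f * X (Sum.inl j) := by
  rw [vf_apply_split X (T := ∅) fun a _ => DFunLike.congr_fun h a, Finset.sum_empty, add_zero]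

theorem D_of_dV_eq_zero (i : Fin 3) {f : Sm} (h : dV f = 0) : D i f = pdA (Sum.inl i.succ) f := by
  simp [vf_of_dV_eq_zero _ h, spaceField]

theorem Dy_of_dV_eq_zero (μ : ℝ) {f : Sm} (h : dV f = 0) : Dy μ f = pdA (Sum.inl 0) f := by
  simp [vf_of_dV_eq_zero _ h, evolField]

theorem D_anti (i : Fin 3) {f : Sm} (h : dV f = 0) : D i (anti i.succ f) = f := by
  rw [D_of_dV_eq_zero i (dV_anti _ h), pdA_anti_self]

/-- A divergence-free triple of functions of the independent variables is a curl. -/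
theorem exists_curl_base {a b c : Sm} (ha : dV a = 0) (hb : dV b = 0) (hc : dV c = 0)
    (h : D 0 a + D 1 b + D 2 c = 0) :
    ∃ l m n : Sm, a = -D 1 l - D 2 m ∧ b = D 0 l - D 2 n ∧ c = D 0 m + D 1 n := by
  have hD : ∀ (i : Fin 3) {f : Sm}, dV f = 0 → dV (D i f) = 0 := fun i f hf => by
    rw [← LD_dV, hf, map_zero]
  set l := anti 1 b with hl
  set m := anti 1 c with hm
  have hl0 : D 0 l = b := D_anti 0 hb
  have hm0 : D 0 m = c := D_anti 0 hc
  have hl' := dV_anti 1 hb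
  have hm' := dV_anti 1 hc
  set r := a + D 1 l + D 2 m with hr
  have hr' : dV r = 0 := by
    rw [hr, map_add, map_add, ha, hD 1 hl', hD 2 hm', add_zero, add_zero]
  have hr0 : D 0 r = 0 := by
    rw [hr, map_add, map_add, D_comm 0 1, D_comm 0 2, hl0, hm0, h]
  -- The antiderivatives in $x$ settle `b` and `c`; the defect `r` in `a` is independent of $x$, and
  -- its antiderivative in $z$ corrects `l` without disturbing `b`.
  set q := anti 2 r
  have hq1 : D 1 q = r := D_anti 1 hr'
  have hq0 : D 0 q = 0 := by
    rw [D_of_dV_eq_zero 0 hr'] at hr0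
    rw [D_of_dV_eq_zero 0 (dV_anti 2 hr')]
    exact pdA_anti_of_ne (by simp) hr0
  refine ⟨l - q, m, 0, ?_, ?_, ?_⟩
  · rw [map_sub, hq1, hr]; ring
  · rw [map_sub, hl0, hq0, map_zero, sub_zero, sub_zero]
  · rw [hm0, map_zero, add_zero]

/-- A divergence-free triple of functions is a curl. -/
theorem exists_curl {a b c : Sm} (h : D 0 a + D 1 b + D 2 c = 0) :
    ∃ l m n : Sm, a = -D 1 l - D 2 m ∧ b = D 0 l - D 2 n ∧ c = D 0 m + D 1 n := by
  obtain ⟨l, m, n, h1, h2, h3⟩ := exists_curl_vForm (a := dV a) (b := dV b) (c := dV c) (by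
    rw [LD_dV, LD_dV, LD_dV, ← map_add, ← map_add, h, map_zero])
  obtain ⟨l', m', n', h1', h2', h3'⟩ := exists_curl_base (dV_base a) (dV_base b) (dV_base c) (by
    rw [D_base, D_base, D_base]
    -- The divergence equation for the restrictions is the given equation evaluated at $v=0$.
    ext p
    have := congrFun (congrArg Sm.val h) (Sum.elim (fun j => p (Sum.inl j)) 0)
    simpa [base_coe] using this)
  have hsplit : ∀ f : Sm, f = integ (dV f) + base f := fun f => by simp [base]
  refine ⟨integ l + l', integ m + m', integ n + n', ?_, ?_, ?_⟩
  · rw [hsplit a, h1, h1']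
    simp only [map_sub, map_neg, map_add, integ_LD]
    ring
  · rw [hsplit b, h2, h2']
    simp only [map_sub, map_add, integ_LD]
    ring
  · rw [hsplit c, h3, h3']
    simp only [map_add, integ_LD]
    ring

/-- A function with vanishing variational derivatives is a divergence. -/
theorem exists_div {f : Sm} (h : ∀ s, euler s (dV f) = 0) :
    ∃ a : Fin 3 → Sm, f = ∑ i, D i (a i) := by
  obtain ⟨a, ha⟩ := exists_div_of_euler h
  refine ⟨a + Pi.single 0 (anti 1 (base f)), ?_⟩
  have : D 0 (anti 1 (base f)) = base f := D_anti 0 (dV_base f)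
  refine ha.trans ?_
  simp only [Fin.sum_univ_three, Pi.add_apply, map_add]
  simp only [Pi.single_eq_same, this, ne_eq, one_ne_zero, not_false_eq_true, Pi.single_eq_of_ne,
    Fin.reduceEq, map_zero]
  ring

/-! ### Cosymmetries -/

theorem dV_jt (s : Fin 2) (a b c : ℕ) : dV (jt s a b c) = Finsupp.single (s, ![a, b, c]) 1 :=
  dV_coord_inr _

theorem D_zero_jt (s : Fin 2) (a b c : ℕ) : D 0 (jt s a b c) = jt s (a + 1) b c := by
  rw [jt, vf_coord, spaceField_inr, jt]
  congr 3
  funext i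
  fin_cases i <;> simp

theorem D_one_jt (s : Fin 2) (a b c : ℕ) : D 1 (jt s a b c) = jt s a (b + 1) c := by
  rw [jt, vf_coord, spaceField_inr, jt]
  congr 3
  funext i
  fin_cases i <;> simp

theorem dV_rhsA (μ : ℝ) : dV (rhsA μ) =
    Finsupp.single (0, ![1, 0, 1]) 2 + Finsupp.single (0, ![2, 0, 0]) (jt 0 1 0 0) +
      Finsupp.single (0, ![1, 0, 0]) (jt 0 2 0 0) - Finsupp.single (0, ![0, 2, 0]) 1 -
      μ • Finsupp.single (0, ![3, 0, 0]) 1 := by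
  have h2 : dV (2 : Sm) = 0 := dV.map_natCast 2
  simp only [rhsA, map_sub, map_add, Derivation.leibniz, Derivation.map_smul, dV_jt, h2, smul_zero,
    add_zero, Finsupp.smul_single, smul_eq_mul, mul_one]
  abel

/-- The adjoint of the linearized equation. -/
theorem euler_smul_dV_rhsA (μ : ℝ) (ψ : Sm) : euler 0 (ψ • dV (rhsA μ)) =
    2 * D 0 (D 2 ψ) + jt 0 1 0 0 * D 0 (D 0 ψ) + jt 0 2 0 0 * D 0 ψ - D 1 (D 1 ψ) +
      μ • D 0 (D 0 (D 0 ψ)) := by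
  have h2 : ∀ i, D i (2 : Sm) = 0 := fun i => (D i).map_natCast 2
  rw [dV_rhsA]
  simp only [smul_sub, smul_add, smul_comm ψ μ, Finsupp.smul_single, map_sub, map_add, map_smul,
    euler_single, smul_eq_mul, if_true, mul_one]
  simp only [adjDI, DI, Fin.sum_univ_three, Matrix.cons_val_zero, Matrix.cons_val_one,
    Matrix.cons_val_two, Matrix.tail_cons, Matrix.head_cons, pow_zero, mul_one,
    one_mul,    LinearMap.smul_apply, Module.End.mul_apply, pow_succ, Derivation.coeFn_coe, zero_add, add_zero]
  -- In $D_x^2(v_x\psi)-D_x(v_{xx}\psi)$ the terms $v_{xxx}\psi$ cancel and one copy of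
  -- $v_{xx}\psi_x$ is left.
  simp only [Derivation.leibniz, map_add, D_zero_jt, smul_eq_mul, h2, mul_zero, add_zero]
  norm_num
  ring

theorem euler_one_smul_dV_rhsA (μ : ℝ) (ψ : Sm) : euler 1 (ψ • dV (rhsA μ)) = 0 := by
  rw [dV_rhsA]
  simp only [smul_sub, smul_add, smul_comm ψ μ, Finsupp.smul_single, map_sub, map_add, map_smul,
    euler_single]
  simp

/-- Modulo divergences a form is determined by its coefficients at $\theta_v$ and $\theta_w$; $D_y$
sends $\theta_v$ to $\theta_w$ and $\theta_w$ to the linearized right-hand side. -/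
theorem euler_LDy (μ : ℝ) (c : VForm) :
    euler 1 (LDy μ c) = Dy μ (euler 1 c) + euler 0 c ∧
      euler 0 (LDy μ c) = Dy μ (euler 0 c) + euler 0 (euler 1 c • dV (rhsA μ)) := by
  obtain ⟨a, ha⟩ := exists_divV_eq c
  have key : LDy μ c = ∑ i, LD i (LDy μ (a i)) +
      (Finsupp.single (0, 0) (Dy μ (euler 0 c)) + Finsupp.single (1, 0) (euler 0 c) +
        (Finsupp.single (1, 0) (Dy μ (euler 1 c)) + euler 1 c • dV (rhsA μ))) := by
    conv_lhs => rw [ha]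
    rw [map_add, map_sum, Fin.sum_univ_two, map_add, LDy_single_zero, LDy_single_one, DI_zero,
      Module.End.one_apply]
    simp only [LDy_LD]
  rw [key]
  simp only [map_add, map_sum, euler_LD, euler_single, euler_one_smul_dV_rhsA, adjDI_zero]
  simp [add_comm]

/-! ### Weights -/

/-- The weight of a jet coordinate. -/
def wt (a : Jet) : ℕ := 2 * ∑ i, a.2 i + 3 * a.1

theorem wt_add_single (s : Fin 2) (I : Fin 3 → ℕ) (i : Fin 3) (n : ℕ) :
    wt (s, I + Pi.single i n) = wt (s, I) + 2 * n := by
  simp [wt, Finset.sum_add_distrib]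
  ring

theorem wt_zero (I : Fin 3 → ℕ) : wt (0, I) = 2 * ∑ i, I i := by simp [wt]

theorem wt_one (I : Fin 3 → ℕ) : wt (1, I) = 2 * ∑ i, I i + 3 := by simp [wt]

/-- The vertical forms of weight less than `n`. -/
noncomputable def W (n : ℕ) : Submodule Sm VForm := Finsupp.supported Sm Sm {a | wt a < n}

theorem mem_W {n : ℕ} {c : VForm} : c ∈ W n ↔ ∀ a, n ≤ wt a → c a = 0 := by
  rw [W, Finsupp.mem_supported']
  simp

theorem W_mono {m n : ℕ} (h : m ≤ n) {c : VForm} (hc : c ∈ W m) : c ∈ W n :=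
  mem_W.2 fun a ha => mem_W.1 hc a (h.trans ha)

theorem single_mem_W {n : ℕ} {a : Jet} (h : wt a < n) (g : Sm) : Finsupp.single a g ∈ W n :=
  Finsupp.single_mem_supported Sm g h

theorem real_smul_mem_W {n : ℕ} (r : ℝ) {c : VForm} (hc : c ∈ W n) : r • c ∈ W n :=
  mem_W.2 fun a ha => by rw [Finsupp.smul_apply, mem_W.1 hc a ha, smul_zero]

theorem map_mem_of_single {n : ℕ} {N : Submodule Sm VForm} {φ : VForm →ₗ[ℝ] VForm}
    (h : ∀ a g, wt a < n → φ (Finsupp.single a g) ∈ N) {c : VForm} (hc : c ∈ W n) : φ c ∈ N := by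
  rw [show c = c.sum Finsupp.single from c.sum_single.symm, Finsupp.sum, map_sum]
  exact N.sum_mem fun a ha => h a _ ((Finsupp.mem_supported Sm c).1 hc ha)

theorem LD_mem_W (i : Fin 3) {n : ℕ} {c : VForm} (hc : c ∈ W n) : LD i c ∈ W (n + 2) := by
  refine map_mem_of_single (fun a g ha => ?_) hc
  rw [LD_single]
  exact add_mem (single_mem_W (by omega) _)
    (single_mem_W (by rw [wt_add_single]; simpa using ha) _)

/-- Only $-\mu v_{xxx}$ reaches weight 6 in the equation, and each space derivative raises the bound
by 2. -/
theorem dV_DI_rhsA_add_mem (μ : ℝ) (I : Fin 3 → ℕ) :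
    dV (DI I (rhsA μ)) + μ • Finsupp.single (0, I + Pi.single 0 3) 1 ∈
      W (2 * ∑ i, I i + 6) := by
  induction I using index_induction with
  | h0 =>
    have h3 : (0 + Pi.single 0 3 : Fin 3 → ℕ) = ![3, 0, 0] := by
      funext i
      fin_cases i <;> simp
    rw [DI_zero, Module.End.one_apply, h3, dV_rhsA, sub_add_cancel]
    have : ∀ J : Fin 3 → ℕ, ∑ i, J i ≤ 2 → ∀ g,
        Finsupp.single ((0, J) : Jet) g ∈ W (2 * ∑ i, (0 : Fin 3 → ℕ) i + 6) := fun J hJ g =>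
      single_mem_W (by rw [wt_zero]; omega) g
    refine sub_mem (add_mem (add_mem ?_ ?_) ?_) ?_ <;> exact this _ (by simp [Fin.sum_univ_three]) _
  | h I i ih =>
    have := LD_mem_W i ih
    rw [map_add, LD_dV, D_DI, map_smul, LD_single, Derivation.map_one_eq_zero,
      Finsupp.single_zero, zero_add] at this
    rw [sum_add_single, add_right_comm I]
    exact this

theorem dV_DI_rhsA_mem (μ : ℝ) (I : Fin 3 → ℕ) :
    dV (DI I (rhsA μ)) ∈ W (2 * ∑ i, I i + 7) := by
  rw [← add_sub_cancel_right (dV (DI I (rhsA μ))) (μ • Finsupp.single (0, I + Pi.single 0 3) 1)]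
  refine sub_mem (W_mono (by omega) (dV_DI_rhsA_add_mem μ I))
    (real_smul_mem_W μ (single_mem_W ?_ 1))
  rw [wt_add_single, wt_zero]
  omega

/-- The weight 3 of $y$ is balanced: $v_I\to w_I$ costs 3, and $w_I\to v_{I+xxx}$ costs $6-3$. -/
theorem LDy_mem_W (μ : ℝ) {n : ℕ} {c : VForm} (hc : c ∈ W n) : LDy μ c ∈ W (n + 3) := by
  refine map_mem_of_single (fun a g ha => ?_) hc
  obtain ⟨s, I⟩ := a
  obtain rfl | rfl : s = 0 ∨ s = 1 := by fin_cases s <;> simp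
  · rw [LDy_single_zero]
    rw [wt_zero] at ha
    exact add_mem (single_mem_W (by rw [wt_zero]; omega) _)
      (single_mem_W (by rw [wt_one]; omega) _)
  · rw [LDy_single_one]
    rw [wt_one] at ha
    exact add_mem (single_mem_W (by rw [wt_one]; omega) _)
      ((W _).smul_mem g (W_mono (by omega) (dV_DI_rhsA_mem μ I)))

theorem LDy_LDy_single_mem (μ : ℝ) (a : Jet) (g : Sm) :
    LDy μ (LDy μ (Finsupp.single a g)) + μ • Finsupp.single (a.1, a.2 + Pi.single 0 3) g ∈
      W (wt a + 6) := by
  have hg : ∀ b : Jet, μ • Finsupp.single b g = g • (μ • Finsupp.single b (1 : Sm)) := fun b => by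
    rw [smul_comm g μ, Finsupp.smul_single g, smul_eq_mul, mul_one]
  obtain ⟨s, I⟩ := a
  obtain rfl | rfl : s = 0 ∨ s = 1 := by fin_cases s <;> simp
  · have h := (W _).smul_mem g (dV_DI_rhsA_add_mem μ I)
    rw [LDy_single_zero, map_add, LDy_single_zero, LDy_single_one, hg, wt_zero,
      add_assoc (_ + _) (_ + _), add_assoc _ (g • _), ← smul_add]
    have h1 := wt_zero I
    have h2 := wt_one I
    exact add_mem (add_mem (single_mem_W (by omega) _) (single_mem_W (by omega) _))
      (add_mem (single_mem_W (by omega) _) h)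
  · have h := LDy_mem_W μ (dV_DI_rhsA_add_mem μ I)
    rw [map_add, map_smul, LDy_single_zero, Derivation.map_one_eq_zero, Finsupp.single_zero,
      zero_add] at h
    have h' := (W _).smul_mem g h
    rw [LDy_single_one, map_add, LDy_single_one, lie_smul, hg, wt_one,
      add_assoc (_ + _) (_ + _), add_assoc _ (g • _), ← smul_add]
    have h2 := wt_one I
    have h3 := (W _).smul_mem (Dy μ g) (dV_DI_rhsA_mem μ I)
    exact add_mem (add_mem (single_mem_W (by omega) _) (W_mono (by omega) h3))
      (add_mem (W_mono (by omega) h3) h')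

theorem LD_LD_LD_single_sub_mem (a : Jet) (g : Sm) :
    LD 0 (LD 0 (LD 0 (Finsupp.single a g))) - Finsupp.single (a.1, a.2 + Pi.single 0 3) g ∈
      W (wt a + 6) := by
  have h3 : a.2 + Pi.single 0 3 = a.2 + Pi.single 0 1 + Pi.single 0 1 + Pi.single 0 1 := by
    simp only [add_assoc, ← Pi.single_add]
    rfl
  simp only [LD_single, map_add, h3]
  have h0 : wt a < wt a + 6 := by omega
  have h1 : wt (a.1, a.2 + Pi.single 0 1) < wt a + 6 := by rw [wt_add_single]; simp
  have h2 : wt (a.1, a.2 + Pi.single 0 1 + Pi.single 0 1) < wt a + 6 := by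
    rw [wt_add_single, wt_add_single]; simp
  rw [← add_assoc _ _
    (Finsupp.single (a.1, a.2 + Pi.single 0 1 + Pi.single 0 1 + Pi.single 0 1) g),
    add_sub_assoc, add_sub_cancel_right]
  refine add_mem (add_mem (add_mem ?_ ?_) (add_mem ?_ ?_)) (add_mem (add_mem ?_ ?_) ?_) <;>
  exact single_mem_W (by assumption) _

/-- The operator sending `g θ_(s,I)` to `g θ_(s,I+xxx)`. -/
noncomputable def shift : VForm →ₗ[ℝ] VForm :=
  Finsupp.lmapDomain Sm ℝ fun a => (a.1, a.2 + Pi.single 0 3)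

theorem shift_single (a : Jet) (g : Sm) :
    shift (Finsupp.single a g) = Finsupp.single (a.1, a.2 + Pi.single 0 3) g :=
  Finsupp.mapDomain_single

theorem shift_apply (c : VForm) (a : Jet) : shift c (a.1, a.2 + Pi.single 0 3) = c a :=
  Finsupp.mapDomain_apply (f := fun a : Jet => (a.1, a.2 + Pi.single 0 3))
    (fun a b h => by simpa [Prod.ext_iff] using h) c a

/-- `LDy` twice and `-μ • LD 0` cubed each contribute $-\mu$ times the shift, whence the factor
$2\mu$. -/
theorem leading_mem (μ : ℝ) {n : ℕ} {c : VForm} (hc : c ∈ W (n + 1)) :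
    LDy μ (LDy μ c) - μ • LD 0 (LD 0 (LD 0 c)) + (2 * μ) • shift c ∈ W (n + 6) := by
  refine map_mem_of_single (φ := LDy μ ∘ₗ LDy μ - μ • (LD 0 ∘ₗ LD 0 ∘ₗ LD 0) + (2 * μ) • shift)
    (fun a g ha => ?_) hc
  have h := sub_mem (LDy_LDy_single_mem μ a g)
    (real_smul_mem_W μ (LD_LD_LD_single_sub_mem a g))
  refine W_mono (m := wt a + 6) (by omega) ?_
  convert h using 1
  simp only [LinearMap.add_apply, LinearMap.sub_apply, LinearMap.smul_apply, LinearMap.comp_apply,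
    shift_single, smul_sub, two_mul, add_smul]
  abel

/-! ### Cosymmetries depend on $y,z,t$ only -/

/-- The equation satisfied by the characteristics. -/
def IsCosymmetry (μ : ℝ) (ψ : Sm) : Prop :=
  Dy μ (Dy μ ψ) = 2 * D 0 (D 2 ψ) + jt 0 1 0 0 * D 0 (D 0 ψ) + jt 0 2 0 0 * D 0 ψ -
    D 1 (D 1 ψ) + μ • D 0 (D 0 (D 0 ψ))

/-- In the cosymmetry equation everything outside $D_y^2\psi-\mu D_x^3\psi$ has at most two space
derivatives of $\psi$, and coefficients of weight at most 4. So the top layer of `dV ψ` survives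
only in the term $2\mu\,$`shift`, and must be zero. -/
theorem IsCosymmetry.mem_W {μ : ℝ} (hμ : μ ≠ 0) {ψ : Sm} (h : IsCosymmetry μ ψ) {n : ℕ}
    (hn : dV ψ ∈ W (n + 1)) : dV ψ ∈ W n := by
  have hlow : LDy μ (LDy μ (dV ψ)) - μ • LD 0 (LD 0 (LD 0 (dV ψ))) ∈ W (n + 6) := by
    have h2 : dV (2 : Sm) = 0 := by
      rw [← one_add_one_eq_two, map_add, Derivation.map_one_eq_zero, add_zero]
    have hD : ∀ i j, dV (D i (D j ψ)) ∈ W (n + 6) := fun i j => by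
      rw [← LD_dV, ← LD_dV]
      exact W_mono (by omega) (LD_mem_W i (LD_mem_W j hn))
    have hD' : dV (D 0 ψ) ∈ W (n + 6) := by
      rw [← LD_dV]
      exact W_mono (by omega) (LD_mem_W 0 hn)
    have hj : ∀ k ≤ 2, dV (jt 0 k 0 0) ∈ W (n + 6) := fun k hk => by
      rw [dV_jt]
      refine single_mem_W ?_ _
      rw [wt_zero]
      simp [Fin.sum_univ_three]
      omega
    rw [LDy_dV, LDy_dV, h]
    simp only [LD_dV, map_add, map_sub, Derivation.map_smul, add_sub_cancel_right,
      Derivation.leibniz, h2, smul_zero, add_zero]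
    have hs : ∀ (g : Sm) {c : VForm}, c ∈ W (n + 6) → g • c ∈ W (n + 6) := fun g _ hc =>
      (W _).smul_mem g hc
    exact sub_mem (add_mem (add_mem (hs _ (hD 0 2)) (add_mem (hs _ (hD 0 0)) (hs _ (hj 1 (by omega)))))
      (add_mem (hs _ hD') (hs _ (hj 2 le_rfl)))) (hD 1 1)
  have hs := sub_mem (leading_mem μ hn) hlow
  rw [add_sub_cancel_left] at hs
  refine ViscousTransonic.mem_W.2 fun a ha => ?_
  have h1 := ViscousTransonic.mem_W.1 hs (a.1, a.2 + Pi.single 0 3) (by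
    rw [wt_add_single]
    exact Nat.add_le_add_right ha 6)
  rw [Finsupp.smul_apply, shift_apply] at h1
  exact (smul_eq_zero.1 h1).resolve_left (by simpa using hμ)

theorem IsCosymmetry.dV_eq_zero {μ : ℝ} (hμ : μ ≠ 0) {ψ : Sm} (h : IsCosymmetry μ ψ) :
    dV ψ = 0 := by
  have h0 : ∀ n, dV ψ ∈ W n → dV ψ ∈ W 0 := fun n => by
    induction n with
    | zero => exact id
    | succ n ih => exact fun hn => ih (h.mem_W hμ hn)
  -- The descent starts above the largest weight in the finite support.
  have h1 : dV ψ ∈ W ((dV ψ).support.sup wt + 1) := by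
    refine ViscousTransonic.mem_W.2 fun a ha => ?_
    by_contra hne
    have := Finset.le_sup (f := wt) (Finsupp.mem_support_iff.2 hne)
    omega
  exact Finsupp.ext fun a => ViscousTransonic.mem_W.1 (h0 _ h1) a (Nat.zero_le _)

theorem dV_D_eq_zero (i : Fin 3) {ψ : Sm} (h : dV ψ = 0) : dV (D i ψ) = 0 := by
  rw [← LD_dV, h, map_zero]

theorem dV_Dy_eq_zero (μ : ℝ) {ψ : Sm} (h : dV ψ = 0) : dV (Dy μ ψ) = 0 := by
  rw [← LDy_dV, h, map_zero]

theorem IsCosymmetry.D_zero_eq_zero {μ : ℝ} (hμ : μ ≠ 0) {ψ : Sm} (h : IsCosymmetry μ ψ) :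
    D 0 ψ = 0 := by
  have h0 := h.dV_eq_zero hμ
  have hD := fun i => dV_D_eq_zero i h0
  have hDD := fun i j => dV_D_eq_zero i (hD j)
  have h2 : dV (2 : Sm) = 0 := dV.map_natCast 2
  have e := congrArg dV h
  simp only [map_add, map_sub, Derivation.map_smul, Derivation.leibniz, h2, hD, hDD,
    dV_D_eq_zero 0 (hDD 0 0), dV_Dy_eq_zero μ (dV_Dy_eq_zero μ h0), smul_zero, add_zero, zero_add,
    sub_zero, dV_jt, Finsupp.smul_single, smul_eq_mul, mul_one] at e
  -- The index is that of $v_{xx}$, whose coefficient in the cosymmetry equation is $\psi_x$.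
  have := DFunLike.congr_fun e (0, ![2, 0, 0])
  simpa using this.symm

theorem IsCosymmetry.laplace {μ : ℝ} (hμ : μ ≠ 0) {ψ : Sm} (h : IsCosymmetry μ ψ) :
    Dy μ (Dy μ ψ) + D 1 (D 1 ψ) = 0 := by
  have h0 := h.D_zero_eq_zero hμ
  rw [h, D_comm 0 2, h0]
  simp

/-! ### Currents -/

theorem euler_apply (s : Fin 2) (c : VForm) {T : Finset (Fin 3 → ℕ)}
    (hT : ∀ I ∉ T, c (s, I) = 0) : euler s c = ∑ I ∈ T, adjDI I (c (s, I)) := by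
  classical
  have hval : ∀ a : Jet, ∀ g, (if a.1 = s then adjDI a.2 else 0 : Module.End ℝ Sm) g =
      if a.1 = s then adjDI a.2 g else 0 := fun a g => by split_ifs <;> rfl
  rw [euler, Finsupp.lsum_apply, Finsupp.sum_of_support_subset (s := c.support ∪ T.image (s, ·)) c
    Finset.subset_union_left _ (by simp), ← Finset.sum_subset Finset.subset_union_right]
  · rw [Finset.sum_image (by simp)]
    exact Finset.sum_congr rfl fun I _ => by rw [hval, if_pos rfl]
  · rintro ⟨s', I⟩ - ha
    rw [hval]
    split_ifs with hs
    · obtain rfl : s' = s := hs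
      rw [hT I fun hI => ha (Finset.mem_image_of_mem _ hI), map_zero]
    · rfl

theorem characteristic_eq (J : Fin 4 → Sm) :
    characteristic (fun k => (J k : Pt → ℝ)) = euler 1 (dV (J 0)) := by
  obtain ⟨T, hT⟩ := exists_pdA_inr_eq_zero (J 0)
  have hT' : ∀ I ∉ T.image Prod.snd, dV (J 0) (1, I) = 0 := fun I hI =>
    hT _ fun h => hI (Finset.mem_image_of_mem Prod.snd h)
  have hc : ∀ I p, (-1 : ℝ) ^ (∑ i, I i) * spaceDIter I (pd (Sum.inr (1, I)) (J 0)) p =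
      (adjDI I (dV (J 0) (1, I)) : Pt → ℝ) p := by
    intro I p
    simp [adjDI, DI_coe]
  funext p
  rw [euler_apply 1 _ hT', Sm.coe_sum, Finset.sum_apply, characteristic,
    finsum_eq_sum_of_support_subset (s := T.image Prod.snd)]
  · exact Finset.sum_congr rfl fun I _ => hc I p
  · intro I hI
    by_contra h
    refine hI ?_
    refine (hc I p).trans ?_
    rw [hT' I h, map_zero]
    rfl

/-- The explicit current. -/
noncomputable def explicitA (μ : ℝ) (ψ : Sm) : Fin 4 → Sm :=
  ![ψ * jt 1 0 0 0 - Dy μ ψ * jt 0 0 0 0,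
    μ • (ψ * jt 0 2 0 0) - (1 / 2 : ℝ) • (ψ * jt 0 1 0 0 ^ 2) - 2 * (ψ * jt 0 0 0 1),
    ψ * jt 0 0 1 0 - D 1 ψ * jt 0 0 0 0,
    0]

theorem Dy_jt_zero (μ : ℝ) : Dy μ (jt 0 0 0 0) = jt 1 0 0 0 := by
  rw [jt, vf_coord, evolField_zero, jt]

theorem Dy_jt_one (μ : ℝ) : Dy μ (jt 1 0 0 0) = rhsA μ := by
  have : (![0, 0, 0] : Fin 3 → ℕ) = 0 := by simp
  rw [jt, vf_coord, evolField_one, this, DI_zero, Module.End.one_apply]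

/-- Since $\psi_x=0$, $\psi$ times every $x$-derivative term of the equation is an $x$-divergence,
with $v_xv_{xx}=D_x(v_x^2/2)$; the $y,z$ part is Green's identity for harmonic $\psi$. -/
theorem explicitA_conserved (μ : ℝ) {ψ : Sm} (h0 : D 0 ψ = 0)
    (h : Dy μ (Dy μ ψ) + D 1 (D 1 ψ) = 0) :
    Dy μ (explicitA μ ψ 0) + D 0 (explicitA μ ψ 1) + D 1 (explicitA μ ψ 2) +
      D 2 (explicitA μ ψ 3) = 0 := by
  have h2 : D 0 (2 : Sm) = 0 := (D 0).map_natCast 2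
  have hhalf : (1 / 2 : ℝ) • (2 : Sm) = 1 := by
    rw [← one_add_one_eq_two (R := Sm), ← two_smul ℝ (1 : Sm), smul_smul]
    norm_num
  simp only [explicitA, Matrix.cons_val_zero, Matrix.cons_val_one, Matrix.cons_val, map_sub,
    Derivation.leibniz, Derivation.map_smul, D_zero_jt, D_one_jt, Dy_jt_zero, Dy_jt_one,
    smul_eq_mul, h0, h2, map_zero, pow_two, rhsA, mul_zero, add_zero, zero_add]
  rw [eq_neg_of_add_eq_zero_left h]
  have hh : (1 / 2 : ℝ) • (ψ * (jt 0 1 0 0 * jt 0 2 0 0 + jt 0 1 0 0 * jt 0 2 0 0)) =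
      ψ * (jt 0 1 0 0 * jt 0 2 0 0) := by
    rw [← two_mul, mul_left_comm, ← smul_mul_assoc, hhalf, one_mul]
  rw [hh, mul_sub ψ, mul_smul_comm]
  ring

theorem euler_explicitA (μ : ℝ) {ψ : Sm} (hψ : dV ψ = 0) :
    euler 1 (dV (explicitA μ ψ 0)) = ψ := by
  have : (![0, 0, 0] : Fin 3 → ℕ) = 0 := by simp
  simp [explicitA, hψ, dV_Dy_eq_zero μ hψ, dV_jt, this, euler_single, adjDI_zero]

/-- Both Euler operators kill the space divergences, so they kill `LDy μ (dV (J 0))`. `euler 1`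
expresses `euler 0 (dV (J 0))` through the characteristic, and `euler 0` then gives the adjoint
equation. -/
theorem isCosymmetry_of_conserved {μ : ℝ} {J : Fin 4 → Sm}
    (h : Dy μ (J 0) + D 0 (J 1) + D 1 (J 2) + D 2 (J 3) = 0) :
    IsCosymmetry μ (euler 1 (dV (J 0))) ∧
      euler 0 (dV (J 0)) = -Dy μ (euler 1 (dV (J 0))) := by
  have hE : ∀ s, euler s (LDy μ (dV (J 0))) = 0 := fun s => by
    have := congrArg (fun f => euler s (dV f)) h
    simpa only [map_add, ← LDy_dV, ← LD_dV, euler_LD, add_zero, map_zero] using this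
  obtain ⟨h1, h0⟩ := euler_LDy μ (dV (J 0))
  rw [hE] at h1 h0
  have e : euler 0 (dV (J 0)) = -Dy μ (euler 1 (dV (J 0))) := (neg_eq_of_add_eq_zero_right h1.symm).symm
  refine ⟨?_, e⟩
  rw [e, map_neg, euler_smul_dV_rhsA, eq_comm, neg_add_eq_zero] at h0
  exact h0

/-- A conserved current with vanishing characteristic is trivial. -/
theorem exists_potential {μ : ℝ} {J : Fin 4 → Sm}
    (h : Dy μ (J 0) + D 0 (J 1) + D 1 (J 2) + D 2 (J 3) = 0)
    (hJ : euler 1 (dV (J 0)) = 0) :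
    ∃ (a : Fin 3 → Sm) (l m n : Sm), J 0 = ∑ i, D i (a i) ∧
      J 1 = -Dy μ (a 0) - D 1 l - D 2 m ∧ J 2 = -Dy μ (a 1) + D 0 l - D 2 n ∧
      J 3 = -Dy μ (a 2) + D 0 m + D 1 n := by
  obtain ⟨a, ha⟩ := exists_div (f := J 0) fun s => by
    obtain rfl | rfl : s = 0 ∨ s = 1 := by fin_cases s <;> simp
    · rw [(isCosymmetry_of_conserved h).2, hJ, map_zero, neg_zero]
    · exact hJ
  obtain ⟨l, m, n, h1, h2, h3⟩ := exists_curl (a := J 1 + Dy μ (a 0)) (b := J 2 + Dy μ (a 1))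
    (c := J 3 + Dy μ (a 2)) (by
      rw [← h, ha, Fin.sum_univ_three]
      simp only [map_add, Dy_D]
      ring)
  refine ⟨a, l, m, n, ha, ?_, ?_, ?_⟩
  · rw [eq_sub_of_add_eq h1]; ring
  · rw [eq_sub_of_add_eq h2]; ring
  · rw [eq_sub_of_add_eq h3]; ring

/-! ### Functions of the independent variables as elements of the algebra -/

theorem pd_lift (j : Fin 4) (χ : (Fin 4 → ℝ) → ℝ) : pd (Sum.inl j) (lift χ) = lift (pd j χ) := by
  funext p
  refine congrArg (fun F : ℝ → ℝ => deriv F (p (Sum.inl j))) (funext fun s => ?_)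
  refine congrArg χ (funext fun i => ?_)
  simp [Function.update_apply]

theorem pd_inr_lift (a : Jet) (χ : (Fin 4 → ℝ) → ℝ) : pd (Sum.inr a) (lift χ) = 0 := by
  funext p
  have : ∀ s, lift χ (Function.update p (Sum.inr a) s) = lift χ p := fun s => by simp [lift]
  simp [pd, this]

theorem isSmooth_lift {χ : (Fin 4 → ℝ) → ℝ} (h : ContDiff ℝ (⊤ : ℕ∞) χ) : IsSmooth (lift χ) :=
  ⟨Finset.univ.disjSum ∅, fun q => χ fun i => q ⟨Sum.inl i, by simp⟩,
    h.comp (by fun_prop), fun _ => rfl⟩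

theorem dV_eq_zero_of_lift {ψ : Sm} {χ : (Fin 4 → ℝ) → ℝ} (h : (ψ : Pt → ℝ) = lift χ) :
    dV ψ = 0 := by
  ext1 a
  refine Sm.ext fun p => ?_
  rw [dV_apply, pdA_coe, h, pd_inr_lift]
  rfl

/-- With `dV ψ = 0` the homotopy formula says that $\psi$ equals its restriction to $v=0$. -/
theorem exists_lift {ψ : Sm} (h : dV ψ = 0) :
    ∃ χ : (Fin 4 → ℝ) → ℝ, ContDiff ℝ (⊤ : ℕ∞) χ ∧ (ψ : Pt → ℝ) = lift χ := by
  obtain ⟨T, g, hg⟩ := ψ.isSmooth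
  refine ⟨fun q => (ψ : Pt → ℝ) (Sum.elim q 0), ?_, ?_⟩
  · simp only [hg.2]
    refine hg.1.comp (contDiff_pi.2 ?_)
    rintro ⟨j | a, hc⟩
    · exact contDiff_apply ℝ ℝ j
    · exact contDiff_const
  · funext p
    have := integ_dV ψ p
    rw [h, map_zero] at this
    exact (sub_eq_zero.1 this.symm)

theorem isAdmissible_iff {μ : ℝ} {ψ : Sm} {χ : (Fin 4 → ℝ) → ℝ} (hχ : ContDiff ℝ (⊤ : ℕ∞) χ)
    (h : (ψ : Pt → ℝ) = lift χ) :
    IsAdmissible χ ↔ D 0 ψ = 0 ∧ Dy μ (Dy μ ψ) + D 1 (D 1 ψ) = 0 := by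
  have h0 := dV_eq_zero_of_lift h
  rw [D_of_dV_eq_zero 0 h0, Dy_of_dV_eq_zero μ (dV_Dy_eq_zero μ h0), Dy_of_dV_eq_zero μ h0,
    D_of_dV_eq_zero 1 (dV_D_eq_zero 1 h0), D_of_dV_eq_zero 1 h0]
  have e1 : (pdA (Sum.inl (Fin.succ 0)) ψ : Pt → ℝ) = lift (pd 1 χ) := by
    rw [pdA_coe, h, pd_lift]; rfl
  have e2 : ∀ j, (pdA (Sum.inl j) (pdA (Sum.inl j) ψ) : Pt → ℝ) = lift (pd j (pd j χ)) := by
    intro j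
    rw [pdA_coe, pdA_coe, h, pd_lift, pd_lift]
  constructor
  · rintro ⟨-, h1, h2⟩
    refine ⟨Sm.ext fun p => ?_, Sm.ext fun p => ?_⟩
    · rw [e1]
      exact h1 _
    · rw [Sm.coe_add, e2, e2]
      exact h2 _
  · rintro ⟨h1, h2⟩
    refine ⟨hχ, fun q => ?_, fun q => ?_⟩
    · have := congrFun (congrArg Sm.val h1) (Sum.elim q 0)
      rw [e1] at this
      exact this
    · have := congrFun (congrArg Sm.val h2) (Sum.elim q 0)
      rw [Sm.coe_add, e2, e2] at this
      exact this

theorem explicitA_coe (μ : ℝ) {ψ : Sm} {χ : (Fin 4 → ℝ) → ℝ} (h : (ψ : Pt → ℝ) = lift χ) :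
    (fun k => (explicitA μ ψ k : Pt → ℝ)) = explicitCurrent μ χ := by
  have h0 := dV_eq_zero_of_lift h
  have hjt : ∀ s a b c, (jt s a b c : Pt → ℝ) = jet s a b c := fun _ _ _ _ => rfl
  have h2 : ((2 : Sm) : Pt → ℝ) = 2 := rfl
  have e0 : (Dy μ ψ : Pt → ℝ) = lift (pd 0 χ) := by
    rw [Dy_of_dV_eq_zero μ h0, pdA_coe, h, pd_lift]
  have e1 : (D 1 ψ : Pt → ℝ) = lift (pd 2 χ) := by
    rw [D_of_dV_eq_zero 1 h0, pdA_coe, h, pd_lift]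
    rfl
  funext k p
  fin_cases k
  · simp [explicitA, explicitCurrent, h, e0, hjt]
  · simp [explicitA, explicitCurrent, h, hjt, h2, pow_two]
    ring
  · simp [explicitA, explicitCurrent, h, e1, hjt]
  · simp [explicitA, explicitCurrent]

theorem isConservedCurrent_iff (μ : ℝ) (J : Fin 4 → Sm) :
    IsConservedCurrent μ (fun k => (J k : Pt → ℝ)) ↔
      Dy μ (J 0) + D 0 (J 1) + D 1 (J 2) + D 2 (J 3) = 0 := by
  have key : ∀ p, ∑ i, totalD μ i (J i) p =
      ((Dy μ (J 0) + D 0 (J 1) + D 1 (J 2) + D 2 (J 3) : Sm) : Pt → ℝ) p := by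
    intro p
    simp only [Fin.sum_univ_four, Sm.coe_add, Pi.add_apply, Dy_coe, D_coe]
    rfl
  constructor
  · exact fun h => Sm.ext fun p => (key p).symm.trans (h.2 p)
  · refine fun h => ⟨fun i => (J i).isSmooth, fun p => ?_⟩
    rw [key, h]
    rfl

theorem isTrivialCurrent_of_potential {μ : ℝ} {J : Fin 4 → Sm} {a : Fin 3 → Sm} {l m n : Sm}
    (h0 : J 0 = ∑ i, D i (a i)) (h1 : J 1 = -Dy μ (a 0) - D 1 l - D 2 m)
    (h2 : J 2 = -Dy μ (a 1) + D 0 l - D 2 n) (h3 : J 3 = -Dy μ (a 2) + D 0 m + D 1 n) :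
    IsTrivialCurrent μ (fun k => (J k : Pt → ℝ)) := by
  -- The first component is $-\sum_l D_lL_{0l}$ in the definition of triviality, hence the minus
  -- signs on `a`.
  let L : Fin 4 → Fin 4 → Sm :=
    ![![0, -a 0, -a 1, -a 2], ![0, 0, l, m], ![0, 0, 0, n], ![0, 0, 0, 0]]
  refine ⟨fun k j => L k j, fun k j _ => (L k j).isSmooth, fun k p => ?_⟩
  have ty : ∀ f : Sm, totalD μ 0 f = Dy μ f := fun f => (Dy_coe μ f).symm
  have tx : ∀ f : Sm, totalD μ 1 f = D 0 f := fun f => (D_coe 0 f).symm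
  have tz : ∀ f : Sm, totalD μ 2 f = D 1 f := fun f => (D_coe 1 f).symm
  have tt : ∀ f : Sm, totalD μ 3 f = D 2 f := fun f => (D_coe 2 f).symm
  rw [Finset.sum_filter, Finset.sum_filter, Fin.sum_univ_four, Fin.sum_univ_four, ty, ty, tx, tx,
    tz, tz, tt, tt]
  fin_cases k
  · simp [L, h0, Fin.sum_univ_three]
    ring
  · simp [L, h1]
    ring
  · simp [L, h2]
  · simp [L, h3]

end ViscousTransonic

/-! ### The classification of conserved currents -/

theorem mainTheorem9 (μ : ℝ) (hμ : μ ≠ 0) :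
    (∀ J : Fin 4 → ViscousTransonic.Pt → ℝ, ViscousTransonic.IsConservedCurrent μ J →
      ∃ χ : (Fin 4 → ℝ) → ℝ, ViscousTransonic.IsAdmissible χ ∧
        ViscousTransonic.characteristic J = ViscousTransonic.lift χ ∧
        ViscousTransonic.CurrentEquiv μ J (ViscousTransonic.explicitCurrent μ χ)) ∧
    (∀ χ : (Fin 4 → ℝ) → ℝ, ViscousTransonic.IsAdmissible χ →
      ViscousTransonic.IsConservedCurrent μ (ViscousTransonic.explicitCurrent μ χ) ∧
        ViscousTransonic.characteristic (ViscousTransonic.explicitCurrent μ χ) =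
          ViscousTransonic.lift χ) := by
  open ViscousTransonic in
  constructor
  · intro J' hJ'
    obtain ⟨J, rfl⟩ : ∃ J : Fin 4 → Sm, J' = fun k => (J k : Pt → ℝ) :=
      ⟨fun k => .mk (J' k) (hJ'.1 k), rfl⟩
    have hJ := (isConservedCurrent_iff μ J).1 hJ'
    have hcos := (isCosymmetry_of_conserved hJ).1
    set ψ := euler 1 (dV (J 0)) with hψ
    have hψ0 := hcos.dV_eq_zero hμ
    obtain ⟨χ, hχ, hlift⟩ := exists_lift hψ0
    have hadm := And.intro (hcos.D_zero_eq_zero hμ) (hcos.laplace hμ)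
    refine ⟨χ, (isAdmissible_iff hχ hlift).2 hadm, by rw [characteristic_eq, ← hψ, hlift], ?_⟩
    have hE := explicitA_conserved μ hadm.1 hadm.2
    -- The characteristic is linear in the current and the explicit current has characteristic `ψ`,
    -- so the difference has characteristic zero.
    obtain ⟨a, l, m, n, h0, h1, h2, h3⟩ := exists_potential (μ := μ) (J := J - explicitA μ ψ)
      (by
        rw [← sub_eq_zero.2 (hJ.trans hE.symm)]
        simp only [Pi.sub_apply, map_sub]
        ring)
      (by rw [Pi.sub_apply, map_sub, map_sub, euler_explicitA μ hψ0, ← hψ, sub_self])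
    rw [CurrentEquiv, ← explicitA_coe μ hlift]
    exact isTrivialCurrent_of_potential h0 h1 h2 h3
  · intro χ hχ
    have hlift : ((Sm.mk (lift χ) (isSmooth_lift hχ.1) : Sm) : Pt → ℝ) = lift χ := rfl
    obtain ⟨h0, h1⟩ := (isAdmissible_iff (μ := μ) hχ.1 hlift).1 hχ
    rw [← explicitA_coe μ hlift, isConservedCurrent_iff, characteristic_eq,
      euler_explicitA μ (dV_eq_zero_of_lift hlift)]
    exact ⟨explicitA_conserved μ h0 h1, hlift⟩
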